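/- Notation. For $n\ge 1$ let $S^{n-1}$ be the unit sphere of $\mathbb{R}^n$ and let $du$ denote $(n-1)$-dimensional Hausdorff (spherical Lebesgue) measure on it. For $v\in S^{n-1}$ and $0<\varepsilon<1$ put $\Sigma_\varepsilon(v)=\{u\in S^{n-1}:\langle u,v\rangle\ge\varepsilon\}$. Let $\mathcal{K}_o^n$ be the set of compact convex sets in $\mathbb{R}^n$ with the origin $o$ in their interiors. For $K\in\mathcal{K}_o^n$ let $h_K(u)=\sup_{x\in K}\langle u,x\rangle$ be its support function, $\rho_K(u)=\sup\{\lambda>0:\lambda u\in K\}$ its radial function, $H(K,u)=\{x\in\mathbb{R}^n:\langle x,u\rangle=h_K(u)\}$ its supporting hyperplane in the direction $u\in S^{n-1}$, and, for almost all $u\in S^{n-1}$, let $\alpha_K(u)$ be the unique outer unit normal vector of $K$ at the boundary point $\rho_K(u)u$. For $E\subset S^{n-1}$ let $$\boldsymbol{\alpha}^*_K(E)=\{x/|x| : x\in\partial K\cap H(K,v)\text{ for some }v\in E\}.$$ For $G:(0,\infty)\times S^{n-1}\to\mathbb{R}$ with continuous partial derivative $G_t(t,u)=\partial G(t,u)/\partial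 t$ and continuous $\psi:(0,\infty)\to(0,\infty)$, the general dual Orlicz curvature measure of $K$ is the finite signed measure $$\widetilde{C}_{G,\psi}(K,E)=\frac1n\int_{\boldsymbol{\alpha}^*_K(E)}\frac{\rho_K(u)\,G_t(\rho_K(u),u)}{\psi(h_K(\alpha_K(u)))}\,du,\qquad E\subset S^{n-1}\ \text{Borel}.$$ A star body is a bounded set $Q\subset\mathbb{R}^n$ with $o\in Q$ and $\lambda x\in Q$ for $x\in Q$, $\lambda\in[0,1]$, whose radial function $\rho_Q(u)=\sup\{\lambda>0:\lambda u\in Q\}$ is positive and continuous on $S^{n-1}$. For $p,q\in\mathbb{R}$, the $(p,q)$-dual curvature measure of $K$ relative to $Q$ is $$\widetilde{C}_{p,q}(K,Q,E)=\frac1n\int_{\boldsymbol{\alpha}^*_K(E)}h_K(\alpha_K(u))^{-p}\rho_K(u)^q\rho_Q(u)^{n-q}\,du,\qquad E\subset S^{n-1}\ \text{Borel}.$$ Theorem. Let $\mu$ be a nonzero finite Borel measure on $S^{n-1}$ not concentrated on any closed hemisphere, that is, $\int_{S^{n-1}}\max\{\langle u,v\rangle,0\}\,d\mu(u)>0$ for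 all $v\in S^{n-1}$. Write $|\mu|=\mu(S^{n-1})$. (i) Let $G:(0,\infty)\times S^{n-1}\to\mathbb{R}$ be such that $G$ and $G_t$ are continuous and $G_t<0$ on $(0,\infty)\times S^{n-1}$. Let $0<\varepsilon_0<1$ and suppose that for all $v\in S^{n-1}$ and $0<\varepsilon\le\varepsilon_0$, $$\lim_{t\to0+}\int_{\Sigma_\varepsilon(v)}G(t,u)\,du=\infty\qquad\text{and}\qquad\lim_{t\to\infty}\int_{S^{n-1}}G(t,u)\,du=0.$$ Let $\psi:(0,\infty)\to(0,\infty)$ be continuous with $\int_1^\infty\frac{\psi(s)}{s}\,ds=\infty$. Then there exists $K\in\mathcal{K}_o^n$ such that $\widetilde{C}_{G,\psi}(K,S^{n-1})\ne0$ and, as measures on the Borel subsets of $S^{n-1}$, $$\frac{\mu}{|\mu|}=\frac{\widetilde{C}_{G,\psi}(K,\cdot)}{\widetilde{C}_{G,\psi}(K,S^{n-1})}.$$ (ii) Let $p>0$, let $q<0$, and let $Q$ be a star body in $\mathbb{R}^n$. Then there exists $K\in\mathcal{K}_o^n$ such that $\mu=\widetilde{C}_{p,q}(K,Q,\cdot)$.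 -/

import Mathlib

open Set Filter Topology MeasureTheory

noncomputable section

namespace DualOrlicz

/-- Euclidean space `ℝⁿ`. -/
abbrev E (n : ℕ) : Type := EuclideanSpace ℝ (Fin n)

/-- The unit sphere `S^{n-1}` of `ℝⁿ`. -/
abbrev Sph (n : ℕ) : Type := Metric.sphere (0 : E n) 1

variable {n : ℕ}

/-- The spherical Lebesgue measure `du` on `S^{n-1}`, that is, `(n-1)`-dimensional Hausdorff measure
with the usual normalization (the surface area measure of polar coordinates;
counting measure on the two points of `S^0` if `n = 1`). -/
def sphMeasure (n : ℕ) : Measure (Sph n) := (volume : Measure (E n)).toSphere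

/-- The class `𝒦ₒⁿ`: compact convex sets having the origin in their interiors. -/
def IsKo (K : ConvexBody (E n)) : Prop := (0 : E n) ∈ interior (K : Set (E n))

/-- The support function `h_K(u) = sup {⟨u, x⟩ : x ∈ K}`. -/
def suppFun (K : Set (E n)) (u : E n) : ℝ := sSup ((fun x => inner ℝ u x) '' K)

/-- The radial function `ρ_L(x) = sup {r > 0 : r x ∈ L}`. -/
def radFun (L : Set (E n)) (x : E n) : ℝ := sSup {r : ℝ | 0 < r ∧ r • x ∈ L}

/-- The supporting hyperplane `H(K, u)` in direction `u`. -/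
def suppPlane (K : Set (E n)) (u : E n) : Set (E n) := {x | inner ℝ x u = suppFun K u}

/-- The multivalued Gauss map: the set of outer unit normals of `K` at the points of `F ⊆ ∂K`. -/
def normalSet (K : Set (E n)) (F : Set (E n)) : Set (Sph n) := {v | ∃ x ∈ F, x ∈ suppPlane K v}

/-- The multivalued radial Gauss map: the set of outer unit normals of `K` at the boundary points
`ρ_K(u) u` with `u ∈ A`. -/
def radGaussSet (K : Set (E n)) (A : Set (Sph n)) : Set (Sph n) :=
  normalSet K ((fun u : Sph n => radFun K (u : E n) • (u : E n)) '' A)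

/-- The reverse radial Gauss image of `A`: the set of directions `x / |x|` of the points
`x ∈ ∂K ∩ H(K, v)` with `v ∈ A`. -/
def revRadGaussSet (K : Set (E n)) (A : Set (Sph n)) : Set (Sph n) :=
  {w | ∃ v ∈ A, ∃ x ∈ frontier K ∩ suppPlane K v, (w : E n) = ‖x‖⁻¹ • x}

open Classical in
/-- The radial Gauss map `α_K`: the unique outer unit normal of `K` at `ρ_K(u) u` where it is
unique, which for a convex body with the origin in its interior is the case for almost all `u`
(elsewhere the value is immaterial). -/
def radGauss (K : Set (E n)) (u : Sph n) : Sph n :=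
  if h : ∃ v, radGaussSet K {u} = {v} then h.choose else u

/-- The partial derivative `G_t(t, u) = ∂G(t, u) / ∂t`. -/
def partialT (G : ℝ → Sph n → ℝ) (t : ℝ) (u : Sph n) : ℝ := deriv (fun s => G s u) t

/-- The general dual Orlicz curvature measure `C̃_{G,ψ}(K, A)` of a Borel set `A ⊆ S^{n-1}`. -/
def curvMeasure (G : ℝ → Sph n → ℝ) (ψ : ℝ → ℝ) (K : Set (E n)) (A : Set (Sph n)) : ℝ :=
  (1 / (n : ℝ)) * ∫ u in revRadGaussSet K A,
    radFun K u * partialT G (radFun K u) u / ψ (suppFun K (radGauss K u)) ∂(sphMeasure n)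

/-- The `(p,q)`-dual curvature measure `C̃_{p,q}(K, Q, A)` of `K` relative to `Q`, of a Borel set
`A ⊆ S^{n-1}`. -/
def pqCurvMeasure (p q : ℝ) (K Q : Set (E n)) (A : Set (Sph n)) : ℝ :=
  (1 / (n : ℝ)) * ∫ u in revRadGaussSet K A,
    suppFun K (radGauss K u) ^ (-p) * radFun K u ^ q * radFun Q u ^ ((n : ℝ) - q) ∂(sphMeasure n)

/-- Star bodies: sets that are star-shaped about the origin with a positive, continuous (real valued)
radial function on the sphere. -/
structure IsStarBody (Q : Set (E n)) : Prop where
  zero_mem : (0 : E n) ∈ Q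
  smul_mem : ∀ x ∈ Q, ∀ r ∈ Icc (0 : ℝ) 1, r • x ∈ Q
  bounded : Bornology.IsBounded Q
  radFun_pos : ∀ u : Sph n, 0 < radFun Q u
  radFun_cont : Continuous (fun u : Sph n => radFun Q u)

/-- The spherical cap `Σ_ε(v) = {u ∈ S^{n-1} : ⟨u, v⟩ ≥ ε}`. -/
def cap (ε : ℝ) (v : Sph n) : Set (Sph n) := {u | ε ≤ inner ℝ (u : E n) (v : E n)}

/-- `μ` is not concentrated on any closed hemisphere: `∫ ⟨u, v⟩₊ dμ(u) > 0` for all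
`v ∈ S^{n-1}`. -/
def NotConcentrated (μ : Measure (Sph n)) : Prop :=
  ∀ v : Sph n, 0 < ∫ u : Sph n, max (inner ℝ (u : E n) (v : E n)) 0 ∂μ

end DualOrlicz

end

noncomputable section

namespace DualOrlicz

variable {n : ℕ}

/-! The body is the Wulff shape of a minimizer. Put φ(t) = ∫₁ᵗ ψ(s)/s ds and let V(f) = ∫ G(ρ(u), u)
du, where ρ is the radial function of the Wulff shape of f. Among positive continuous f, one
minimizes ∫ φ(f) dμ under an upper bound on V(f): small f lowers the objective but raises V.

Replacing f by the support function `hull f` of its Wulff shape keeps V and does not raise the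
objective, so only support functions compete. The blow-up of G on caps bounds them below
(`exists_lower_bound`); since μ is not concentrated on a hemisphere and φ → ∞, they are bounded
above (`exists_upper_bound`). Arzelà–Ascoli then yields a minimizer (`exists_minimizer`).

In terms of r = 1/f, the gauge of the Wulff shape is `polarFun r` = 1/ρ. It is Lipschitz, so by
Rademacher almost every direction has a unique maximizer `argPolar r`, which is the radial Gauss map
α. An envelope argument (`hasDerivAt_polarFun`) differentiates V, and the Lagrange multiplier rule
(`exists_multiplier`) gives ∫ g dμ = l ∫ w · (g ∘ α) du for all continuous g, with w = ρ G_t(ρ,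
·)/ψ(h(α)). Hence μ is proportional to the curvature measure.

For (ii) take G(t, u) = t^q ρ_Q(u)^(n-q) and ψ(t) = t^p; the measure is homogeneous of degree q - p
≠ 0 in K, so a dilation removes the factor. -/

/-! ### Support functions of radial graphs -/

/-- The support function `x ↦ max_v r(v) ⟨x, v⟩` of the radial graph `{r(v) v : v ∈ S^{n-1}}`. -/
def polarFun (r : Sph n → ℝ) (x : E n) : ℝ := ⨆ v : Sph n, inner ℝ x (v : E n) * r v

theorem continuous_inner_mul {r : Sph n → ℝ} (hr : Continuous r) (x : E n) :
    Continuous fun v : Sph n => inner ℝ x (v : E n) * r v := by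
  fun_prop

theorem inner_mul_le_polarFun {r : Sph n → ℝ} (hr : Continuous r) (x : E n) (v : Sph n) :
    inner ℝ x (v : E n) * r v ≤ polarFun r x :=
  le_ciSup (isCompact_range (continuous_inner_mul hr x)).bddAbove v

theorem polarFun_le [Nonempty (Sph n)] {r : Sph n → ℝ} {x : E n} {b : ℝ}
    (h : ∀ v : Sph n, inner ℝ x (v : E n) * r v ≤ b) : polarFun r x ≤ b :=
  ciSup_le h

theorem exists_polarFun_eq [Nonempty (Sph n)] {r : Sph n → ℝ} (hr : Continuous r) (x : E n) :
    ∃ v : Sph n, inner ℝ x (v : E n) * r v = polarFun r x := by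
  obtain ⟨v, hv⟩ := (isCompact_range (continuous_inner_mul hr x)).sSup_mem (range_nonempty _)
  exact ⟨v, hv⟩

theorem norm_sph (v : Sph n) : ‖(v : E n)‖ = 1 := by simp

theorem inner_sph_self (v : Sph n) : inner ℝ (v : E n) (v : E n) = 1 := by
  rw [real_inner_self_eq_norm_sq, norm_sph, one_pow]

theorem abs_inner_sph_le (x : E n) (v : Sph n) : |inner ℝ x (v : E n)| ≤ ‖x‖ := by
  simpa using abs_real_inner_le_norm x (v : E n)

theorem polarFun_smul [Nonempty (Sph n)] {r : Sph n → ℝ} (hr : Continuous r) {c : ℝ} (hc : 0 ≤ c)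
    (x : E n) : polarFun r (c • x) = c * polarFun r x := by
  apply le_antisymm
  · refine polarFun_le fun v => ?_
    rw [real_inner_smul_left, mul_assoc]
    exact mul_le_mul_of_nonneg_left (inner_mul_le_polarFun hr x v) hc
  · obtain ⟨v, hv⟩ := exists_polarFun_eq hr x
    rw [← hv, ← mul_assoc, ← real_inner_smul_left]
    exact inner_mul_le_polarFun hr _ v

theorem polarFun_zero [Nonempty (Sph n)] {r : Sph n → ℝ} (hr : Continuous r) :
    polarFun r (0 : E n) = 0 := by
  simpa using polarFun_smul hr le_rfl (0 : E n)

theorem polarFun_sub_le [Nonempty (Sph n)] {r : Sph n → ℝ} (hr : Continuous r) {B : ℝ}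
    (hB : ∀ v, |r v| ≤ B) (x y : E n) : polarFun r x - polarFun r y ≤ B * ‖x - y‖ := by
  rw [sub_le_iff_le_add]
  refine polarFun_le fun v => ?_
  have h1 := inner_mul_le_polarFun hr y v
  have h2 : inner ℝ (x - y) (v : E n) * r v ≤ ‖x - y‖ * B := by
    refine (le_abs_self _).trans ?_
    rw [abs_mul]
    exact mul_le_mul (abs_inner_sph_le _ v) (hB v) (abs_nonneg _) (norm_nonneg _)
  rw [inner_sub_left] at h2
  linarith

theorem lipschitzWith_polarFun [Nonempty (Sph n)] {r : Sph n → ℝ} (hr : Continuous r) {B : NNReal}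
    (hB : ∀ v, |r v| ≤ B) : LipschitzWith B (polarFun r) := by
  refine LipschitzWith.of_dist_le_mul fun x y => ?_
  rw [Real.dist_eq, dist_eq_norm, abs_sub_le_iff]
  refine ⟨polarFun_sub_le hr hB x y, ?_⟩
  rw [norm_sub_rev]
  exact polarFun_sub_le hr hB y x

theorem exists_abs_le {r : Sph n → ℝ} (hr : Continuous r) : ∃ B : NNReal, ∀ v, |r v| ≤ B := by
  obtain ⟨B, hB⟩ := (isCompact_range hr.abs).bddAbove
  refine ⟨B.toNNReal, fun v => ?_⟩
  exact (hB (mem_range_self v)).trans (Real.le_coe_toNNReal B)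

theorem continuous_polarFun [Nonempty (Sph n)] {r : Sph n → ℝ} (hr : Continuous r) :
    Continuous (polarFun r) := by
  obtain ⟨B, hB⟩ := exists_abs_le hr
  exact (lipschitzWith_polarFun hr hB).continuous

theorem abs_polarFun_sub_le [Nonempty (Sph n)] {r s : Sph n → ℝ} (hr : Continuous r)
    (hs : Continuous s) {d : ℝ} (hd : ∀ v, |r v - s v| ≤ d) (u : Sph n) :
    |polarFun r u - polarFun s u| ≤ d := by
  have key : ∀ {r s : Sph n → ℝ}, Continuous s → (∀ v, |r v - s v| ≤ d) →
      polarFun r u - polarFun s u ≤ d := by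
    intro r s hs hd
    rw [sub_le_iff_le_add]
    refine polarFun_le fun v => ?_
    have h1 := inner_mul_le_polarFun hs (u : E n) v
    have h2 : inner ℝ (u : E n) (v : E n) * (r v - s v) ≤ 1 * d := by
      refine (le_abs_self _).trans ?_
      rw [abs_mul]
      exact mul_le_mul (by simpa using abs_inner_sph_le (u : E n) v) (hd v) (abs_nonneg _)
        zero_le_one
    linarith
  exact abs_sub_le_iff.2 ⟨key hs hd, key hr fun v => by rw [abs_sub_comm]; exact hd v⟩

theorem le_polarFun_self {r : Sph n → ℝ} (hr : Continuous r) (u : Sph n) :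
    r u ≤ polarFun r u := by
  simpa [inner_sph_self] using inner_mul_le_polarFun hr (u : E n) u

theorem polarFun_le_of_le [Nonempty (Sph n)] {r : Sph n → ℝ} {B : ℝ} (hr : ∀ v, 0 < r v)
    (hB : ∀ v, r v ≤ B) (u : Sph n) : polarFun r u ≤ B := by
  refine polarFun_le fun v => ?_
  have h := abs_inner_sph_le (u : E n) v
  rw [norm_sph] at h
  nlinarith [hr v, hB v, le_abs_self (inner ℝ (u : E n) (v : E n))]

theorem polarFun_pos {r : Sph n → ℝ} (hr : Continuous r) (h0 : ∀ v, 0 < r v) (u : Sph n) :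
    0 < polarFun r u :=
  (h0 u).trans_le (le_polarFun_self hr u)

/-! ### Hulls: support functions of Wulff shapes -/

/-- The support function of the Wulff shape of `f`. -/
def hull (f : Sph n → ℝ) (v : Sph n) : ℝ :=
  polarFun (fun u : Sph n => (polarFun (fun w => (f w)⁻¹) (u : E n))⁻¹) v

theorem inv_polarFun_inv_pos {f : Sph n → ℝ} (hf : Continuous f) (h0 : ∀ v, 0 < f v) (u : Sph n) :
    0 < (polarFun (fun w => (f w)⁻¹) (u : E n))⁻¹ :=
  inv_pos.2 (polarFun_pos (hf.inv₀ fun v => (h0 v).ne') (fun v => inv_pos.2 (h0 v)) u)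

section hull

variable [Nonempty (Sph n)] {f : Sph n → ℝ}

theorem continuous_inv_polarFun_inv (hf : Continuous f) (h0 : ∀ v, 0 < f v) :
    Continuous fun u : Sph n => (polarFun (fun w => (f w)⁻¹) (u : E n))⁻¹ := by
  have hc : Continuous fun w => (f w)⁻¹ := hf.inv₀ fun v => (h0 v).ne'
  exact ((continuous_polarFun hc).comp continuous_subtype_val).inv₀ fun u =>
    (polarFun_pos hc (fun v => inv_pos.2 (h0 v)) u).ne'

theorem continuous_hull (hf : Continuous f) (h0 : ∀ v, 0 < f v) : Continuous (hull f) :=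
  (continuous_polarFun (continuous_inv_polarFun_inv hf h0)).comp continuous_subtype_val

theorem hull_pos (hf : Continuous f) (h0 : ∀ v, 0 < f v) (v : Sph n) : 0 < hull f v :=
  polarFun_pos (continuous_inv_polarFun_inv hf h0) (inv_polarFun_inv_pos hf h0) v

theorem hull_le (hf : Continuous f) (h0 : ∀ v, 0 < f v) (v : Sph n) : hull f v ≤ f v := by
  refine polarFun_le fun u => ?_
  have hc : Continuous fun w => (f w)⁻¹ := hf.inv₀ fun v => (h0 v).ne'
  have h := inner_mul_le_polarFun hc (u : E n) v
  have hN := inv_polarFun_inv_pos hf h0 u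
  rw [inv_pos] at hN
  rw [← div_eq_mul_inv, div_le_iff₀ (h0 v)] at h
  rw [← div_eq_mul_inv, div_le_iff₀ hN, real_inner_comm, mul_comm (f v)]
  exact h

/-- A function and its hull have the same Wulff shape, hence the same gauge. One inequality holds
because `hull f v` is a supremum of ⟨v, u⟩ρ(u); the other follows from `hull f ≤ f`. -/
theorem polarFun_inv_hull (hf : Continuous f) (h0 : ∀ v, 0 < f v) (u : Sph n) :
    polarFun (fun w => (hull f w)⁻¹) u = polarFun (fun w => (f w)⁻¹) u := by
  have hc : Continuous fun w => (f w)⁻¹ := hf.inv₀ fun v => (h0 v).ne'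
  have hN := polarFun_pos hc (fun v => inv_pos.2 (h0 v)) u
  apply le_antisymm
  · refine polarFun_le fun v => ?_
    have h := inner_mul_le_polarFun (continuous_inv_polarFun_inv hf h0) (v : E n) u
    change _ ≤ hull f v at h
    rw [← div_eq_mul_inv, div_le_iff₀ hN] at h
    rw [← div_eq_mul_inv, div_le_iff₀ (hull_pos hf h0 v), real_inner_comm, mul_comm]
    exact h
  · obtain ⟨v, hv⟩ := exists_polarFun_eq hc (u : E n)
    -- Lowering f to its hull increases the term at v only if ⟨u, v⟩ > 0, which holds at a
    -- maximizer.
    have hpos : 0 < inner ℝ (u : E n) (v : E n) := by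
      rw [← hv] at hN
      exact pos_of_mul_pos_left hN (inv_pos.2 (h0 v)).le
    rw [← hv]
    refine le_trans ?_ (inner_mul_le_polarFun ((continuous_hull hf h0).inv₀ fun v =>
      (hull_pos hf h0 v).ne') (u : E n) v)
    exact mul_le_mul_of_nonneg_left (inv_anti₀ (hull_pos hf h0 v) (hull_le hf h0 v)) hpos.le

theorem hull_hull (hf : Continuous f) (h0 : ∀ v, 0 < f v) (v : Sph n) :
    hull (hull f) v = hull f v := by
  unfold hull
  congr 1
  ext u
  exact congrArg _ (polarFun_inv_hull hf h0 u)

end hull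

/-! ### Almost everywhere uniqueness and measurability of the maximizer -/

/-- At a point of differentiability the maximizer in the definition of `polarFun` is determined by
the gradient. -/
theorem smul_eq_gradient {r : Sph n → ℝ} (hr : Continuous r) {x : E n}
    (hx : DifferentiableAt ℝ (polarFun r) x) {v : Sph n}
    (hv : inner ℝ x (v : E n) * r v = polarFun r x) :
    r v • (v : E n) = gradient (polarFun r) x := by
  have hL : HasFDerivAt (fun y : E n => polarFun r y - inner ℝ (r v • (v : E n)) y)
      (fderiv ℝ (polarFun r) x - innerSL ℝ (r v • (v : E n))) x :=
    hx.hasFDerivAt.sub (innerSL ℝ (r v • (v : E n))).hasFDerivAt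
  -- The linear functional of a maximizer lies below `polarFun r` and touches it at x, so the
  -- difference has its minimum 0 there.
  have hmin : IsLocalMin (fun y : E n => polarFun r y - inner ℝ (r v • (v : E n)) y) x := by
    refine Eventually.of_forall fun y => ?_
    have h1 := inner_mul_le_polarFun hr y v
    simp only [real_inner_smul_left, real_inner_comm _ (v : E n)] at *
    linarith
  have h0 := hmin.hasFDerivAt_eq_zero hL
  rw [sub_eq_zero] at h0
  unfold gradient
  rw [h0]
  exact ((InnerProductSpace.toDual ℝ (E n)).symm_apply_apply (r v • (v : E n))).symm

/-- Both vectors r(v)v and r(w)w equal the gradient; comparing norms gives r(v) = r(w), then v = w.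
Geometrically, the outer normal is unique. -/
theorem eq_of_polarFun_eq {r : Sph n → ℝ} (hr : Continuous r) (h0 : ∀ v, 0 < r v) {x : E n}
    (hx : DifferentiableAt ℝ (polarFun r) x) {v w : Sph n}
    (hv : inner ℝ x (v : E n) * r v = polarFun r x)
    (hw : inner ℝ x (w : E n) * r w = polarFun r x) : v = w := by
  have h := (smul_eq_gradient hr hx hv).trans (smul_eq_gradient hr hx hw).symm
  have hn := congrArg norm h
  simp only [norm_smul, norm_sph, mul_one, Real.norm_eq_abs, abs_of_pos (h0 _)] at hn
  rw [hn] at h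
  exact Subtype.ext (smul_right_injective _ (h0 w).ne' h)

instance : IsFiniteMeasure (sphMeasure n) := by unfold sphMeasure; infer_instance

instance : (sphMeasure n).IsOpenPosMeasure := by unfold sphMeasure; infer_instance

open scoped Pointwise in
/-- A homogeneous property that holds almost everywhere in space holds almost everywhere on the
sphere. -/
theorem ae_sphMeasure_of_ae {P : E n → Prop} (hm : MeasurableSet {x | P x})
    (hP : ∀ᵐ x ∂(volume : Measure (E n)), P x)
    (hs : ∀ (c : ℝ) (x : E n), 0 < c → P (c • x) → P x) :
    ∀ᵐ u : Sph n ∂(sphMeasure n), P (u : E n) := by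
  have hm' : MeasurableSet {u : Sph n | ¬ P (u : E n)} :=
    (measurable_subtype_coe hm).compl
  rw [ae_iff, sphMeasure, Measure.toSphere_apply' _ hm']
  -- The spherical measure of a set is a multiple of the volume of the cone over it, and homogeneity
  -- puts the whole cone in the exceptional null set.
  have : volume (Ioo (0 : ℝ) 1 • (Subtype.val '' {u : Sph n | ¬ P (u : E n)})) = 0 := by
    refine measure_mono_null ?_ (ae_iff.1 hP)
    rintro _ ⟨c, hc, _, ⟨u, hu, rfl⟩, rfl⟩
    exact fun h => hu (hs c u hc.1 h)
  rw [this, mul_zero]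

/-- Rademacher's theorem in space, transferred to the sphere because differentiability of a
positively homogeneous function propagates along rays. -/
theorem ae_differentiableAt_polarFun [Nonempty (Sph n)] {r : Sph n → ℝ} (hr : Continuous r) :
    ∀ᵐ u : Sph n ∂(sphMeasure n), DifferentiableAt ℝ (polarFun r) (u : E n) := by
  obtain ⟨B, hB⟩ := exists_abs_le hr
  refine ae_sphMeasure_of_ae (measurableSet_of_differentiableAt ℝ _)
    (lipschitzWith_polarFun hr hB).ae_differentiableAt fun c x hc h => ?_
  have h1 : DifferentiableAt ℝ (fun y : E n => c⁻¹ * polarFun r (c • y)) x :=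
    (DifferentiableAt.comp x h (differentiableAt_id.const_smul c)).const_mul _
  refine h1.congr_of_eventuallyEq (Eventually.of_forall fun y => ?_)
  simp only [polarFun_smul hr hc.le]
  field_simp

/-- A choice of maximizer in the definition of `polarFun`. -/
def argPolar [Nonempty (Sph n)] (r : Sph n → ℝ) (u : Sph n) : Sph n :=
  Classical.epsilon fun v : Sph n => inner ℝ (u : E n) (v : E n) * r v = polarFun r u

theorem argPolar_spec [Nonempty (Sph n)] {r : Sph n → ℝ} (hr : Continuous r) (u : Sph n) :
    inner ℝ (u : E n) (argPolar r u : E n) * r (argPolar r u) = polarFun r u :=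
  Classical.epsilon_spec (exists_polarFun_eq hr (u : E n))

/-- The choice of maximizer carries no measurability by itself, but almost everywhere it is the
normalized gradient, which is measurable. -/
theorem aemeasurable_argPolar [Nonempty (Sph n)] {r : Sph n → ℝ} (hr : Continuous r)
    (h0 : ∀ v, 0 < r v) : AEMeasurable (argPolar r) (sphMeasure n) := by
  have hemb : MeasurableEmbedding (Subtype.val : Sph n → E n) :=
    MeasurableEmbedding.subtype_coe Metric.isClosed_sphere.measurableSet
  rw [← hemb.aemeasurable_comp_iff]
  have hg : Measurable fun u : Sph n => gradient (polarFun r) (u : E n) :=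
    ((InnerProductSpace.toDual ℝ (E n)).symm.continuous.measurable.comp
      (measurable_fderiv ℝ _)).comp measurable_subtype_coe
  refine ⟨fun u => ‖gradient (polarFun r) (u : E n)‖⁻¹ • gradient (polarFun r) (u : E n),
    hg.norm.inv.smul hg, ?_⟩
  filter_upwards [ae_differentiableAt_polarFun hr] with u hu
  rw [← smul_eq_gradient hr hu (argPolar_spec hr u), norm_smul, norm_sph, mul_one,
    Real.norm_of_nonneg (h0 _).le, inv_smul_smul₀ (h0 _).ne']
  rfl

/-! ### First variation and Lagrange multiplier -/

/-- Envelope theorem: the derivative of a maximum is the derivative of the maximized expression at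
the unique maximizer α. Perturbed maximizers converge to α, and testing each problem with the
other's maximizer squeezes the difference quotient. -/
theorem hasDerivAt_polarFun [Nonempty (Sph n)] {r k : Sph n → ℝ} (hr : Continuous r)
    (h0 : ∀ v, 0 < r v) (hk : Continuous k) {u : Sph n}
    (hu : DifferentiableAt ℝ (polarFun r) (u : E n)) :
    HasDerivAt (fun t : ℝ => polarFun (fun v => r v + t * k v) (u : E n))
      (inner ℝ (u : E n) (argPolar r u : E n) * k (argPolar r u)) 0 := by
  set α := argPolar r u with hα
  have hc : ∀ t : ℝ, Continuous fun v => r v + t * k v := fun t => by fun_prop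
  choose a ha using fun t : ℝ => exists_polarFun_eq (hc t) (u : E n)
  obtain ⟨B, hB⟩ := exists_abs_le hk
  have hD0 : polarFun (fun v => r v + 0 * k v) (u : E n) = polarFun r u := by simp
  have hj : Continuous fun v : Sph n => inner ℝ (u : E n) (v : E n) * r v :=
    continuous_inner_mul hr _
  have hlim : Tendsto (fun t => polarFun (fun v => r v + t * k v) (u : E n)) (𝓝 0)
      (𝓝 (polarFun r u)) := by
    rw [tendsto_iff_dist_tendsto_zero]
    refine squeeze_zero (fun _ => dist_nonneg) (g := fun t : ℝ => |t| * B) (fun t => ?_) ?_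
    · rw [Real.dist_eq]
      refine abs_polarFun_sub_le (hc t) hr (fun v => ?_) u
      rw [add_sub_cancel_left, abs_mul]
      exact mul_le_mul_of_nonneg_left (hB v) (abs_nonneg t)
    · have : Tendsto (fun t : ℝ => |t| * B) (𝓝 0) (𝓝 (|0| * B)) := by
        apply Continuous.tendsto; fun_prop
      simpa using this
  have hja : Tendsto (fun t => inner ℝ (u : E n) (a t : E n) * r (a t)) (𝓝 0)
      (𝓝 (polarFun r u)) := by
    have h2 : Tendsto (fun t => t * (inner ℝ (u : E n) (a t : E n) * k (a t))) (𝓝 0) (𝓝 0) := by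
      refine squeeze_zero_norm (a := fun t : ℝ => |t| * B) (fun t => ?_) ?_
      · rw [Real.norm_eq_abs, abs_mul, abs_mul]
        refine mul_le_mul_of_nonneg_left ?_ (abs_nonneg t)
        have := abs_inner_sph_le (u : E n) (a t)
        rw [norm_sph] at this
        calc _ ≤ 1 * (B : ℝ) := mul_le_mul this (hB _) (abs_nonneg _) zero_le_one
          _ = B := one_mul _
      · have : Tendsto (fun t : ℝ => |t| * B) (𝓝 0) (𝓝 (|0| * B)) := by
          apply Continuous.tendsto; fun_prop
        simpa using this
    have h3 := hlim.sub h2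
    rw [sub_zero] at h3
    refine h3.congr fun t => ?_
    rw [← ha t]
    ring
  -- By compactness of the sphere it suffices that each cluster point of the maximizers a(t) is a
  -- maximizer for t = 0, hence equals α.
  have hat : Tendsto a (𝓝 0) (𝓝 α) := by
    refine tendsto_nhds_of_unique_mapClusterPt fun v hv => ?_
    have h1 : MapClusterPt (inner ℝ (u : E n) (v : E n) * r v) (𝓝 0)
        (fun t => inner ℝ (u : E n) (a t : E n) * r (a t)) :=
      hv.tendsto_comp hj.continuousAt
    have h2 : inner ℝ (u : E n) (v : E n) * r v = polarFun r u := by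
      have : ClusterPt (inner ℝ (u : E n) (v : E n) * r v) (𝓝 (polarFun r (u : E n))) :=
        ClusterPt.mono h1 hja
      exact eq_of_nhds_neBot this
    exact eq_of_polarFun_eq hr h0 hu h2 (argPolar_spec hr u)
  have hw : Tendsto (fun t => inner ℝ (u : E n) (a t : E n) * k (a t)) (𝓝 0)
      (𝓝 (inner ℝ (u : E n) (α : E n) * k α)) :=
    ((continuous_inner_mul hk (u : E n)).tendsto α).comp hat
  rw [hasDerivAt_iff_isLittleO, Asymptotics.isLittleO_iff]
  intro c hcpos
  have hev := Metric.tendsto_nhds.1 hw c hcpos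
  filter_upwards [hev] with t ht
  rw [hD0, sub_zero, smul_eq_mul, Real.norm_eq_abs, Real.norm_eq_abs]
  rw [Real.dist_eq] at ht
  have lower := inner_mul_le_polarFun (hc t) (u : E n) α
  have upper := inner_mul_le_polarFun hr (u : E n) (a t)
  have hat' := ha t
  have hαs := argPolar_spec hr u
  rw [← hα] at hαs
  have e1 : 0 ≤ polarFun (fun v => r v + t * k v) (u : E n) - polarFun r u
      - t * (inner ℝ (u : E n) (α : E n) * k α) := by
    linarith
  have e2 : polarFun (fun v => r v + t * k v) (u : E n) - polarFun r u
      - t * (inner ℝ (u : E n) (α : E n) * k α) ≤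
      t * (inner ℝ (u : E n) (a t : E n) * k (a t) - inner ℝ (u : E n) (α : E n) * k α) := by
    linarith
  rw [abs_of_nonneg e1]
  refine e2.trans ((le_abs_self _).trans ?_)
  rw [abs_mul, mul_comm]
  exact mul_le_mul_of_nonneg_right ht.le (abs_nonneg t)

theorem continuous_comp_of_pos {Γ : ℝ → Sph n → ℝ}
    (hΓ : ContinuousOn (fun p : ℝ × Sph n => Γ p.1 p.2) (Ioi 0 ×ˢ univ)) {D : Sph n → ℝ}
    (hD : Continuous D) (h0 : ∀ u, 0 < D u) : Continuous fun u => Γ (D u) u :=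
  hΓ.comp_continuous (hD.prodMk continuous_id) fun u => ⟨h0 u, mem_univ _⟩

theorem exists_abs_le_of_Icc {Γ : ℝ → Sph n → ℝ}
    (hΓ : ContinuousOn (fun p : ℝ × Sph n => Γ p.1 p.2) (Ioi 0 ×ˢ univ)) {a : ℝ} (ha : 0 < a)
    (b : ℝ) : ∃ C : ℝ, 0 ≤ C ∧ ∀ s ∈ Icc a b, ∀ u, |Γ s u| ≤ C := by
  have hK : IsCompact (Icc a b ×ˢ (univ : Set (Sph n))) := isCompact_Icc.prod isCompact_univ
  obtain ⟨C, hC⟩ := hK.exists_bound_of_continuousOn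
    (hΓ.mono (prod_mono (fun s hs => ha.trans_le hs.1) subset_rfl))
  exact ⟨max C 0, le_max_right _ _,
    fun s hs u => (hC (s, u) ⟨hs, mem_univ _⟩).trans (le_max_left _ _)⟩

theorem integrable_of_continuous {ν : Measure (Sph n)} [IsFiniteMeasure ν] {g : Sph n → ℝ}
    (hg : Continuous g) : Integrable g ν := by
  obtain ⟨B, hB⟩ := exists_abs_le hg
  exact Integrable.of_bound hg.aestronglyMeasurable B (Eventually.of_forall hB)

theorem exists_pos_le [Nonempty (Sph n)] {D : Sph n → ℝ} (hD : Continuous D) (h0 : ∀ u, 0 < D u) :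
    ∃ a b, 0 < a ∧ ∀ u, D u ∈ Icc a b := by
  obtain ⟨x, -, hx⟩ := isCompact_univ.exists_isMinOn (univ_nonempty (α := Sph n)) hD.continuousOn
  obtain ⟨B, hB⟩ := exists_abs_le hD
  exact ⟨D x, B, h0 x, fun u => ⟨hx (mem_univ u), (le_abs_self _).trans (hB u)⟩⟩

/-- Differentiation under the integral sign, stated generally enough to cover both the constraint
(spherical measure) and the objective (μ). -/
theorem hasDerivAt_integral_comp [Nonempty (Sph n)] {ν : Measure (Sph n)} [IsFiniteMeasure ν]
    {Γ Γ' : ℝ → Sph n → ℝ}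
    (hΓ : ContinuousOn (fun p : ℝ × Sph n => Γ p.1 p.2) (Ioi 0 ×ˢ univ))
    (hΓ' : ContinuousOn (fun p : ℝ × Sph n => Γ' p.1 p.2) (Ioi 0 ×ˢ univ))
    (hd : ∀ s > 0, ∀ u, HasDerivAt (fun s => Γ s u) (Γ' s u) s)
    {D : ℝ → Sph n → ℝ} {D' : Sph n → ℝ} {M : ℝ} (hDc : ∀ t, Continuous (D t))
    (hL : ∀ t s u, |D t u - D s u| ≤ M * |t - s|) (h0 : ∀ u, 0 < D 0 u)
    (hm : AEStronglyMeasurable D' ν) (hD' : ∀ᵐ u ∂ν, HasDerivAt (fun t => D t u) (D' u) 0) :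
    HasDerivAt (fun t => ∫ u, Γ (D t u) u ∂ν) (∫ u, Γ' (D 0 u) u * D' u ∂ν) 0 := by
  obtain ⟨a, b, ha, hab⟩ := exists_pos_le (hDc 0) h0
  have hM : 0 ≤ M := by
    have u := Classical.arbitrary (Sph n)
    simpa using (abs_nonneg _).trans (hL 1 0 u)
  obtain ⟨C, hC0, hC⟩ := exists_abs_le_of_Icc hΓ' (half_pos ha) (b + a)
  -- For |t| < δ the values D t move by at most Mδ ≤ a/2, so they stay in [a/2, b + a], where Γ' is
  -- bounded; M + 1 covers M = 0.
  set δ := a / (2 * (M + 1)) with hδ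
  have hδ0 : 0 < δ := by positivity
  have hMδ : M * δ ≤ a / 2 := by
    rw [hδ, mul_div_assoc', div_le_div_iff₀ (by positivity) two_pos]
    nlinarith
  have hmem : ∀ t ∈ Metric.ball (0 : ℝ) δ, ∀ u, D t u ∈ Icc (a / 2) (b + a) := by
    intro t ht u
    rw [mem_ball_zero_iff, Real.norm_eq_abs] at ht
    have h1 := (hL t 0 u).trans (mul_le_mul_of_nonneg_left (by simpa using ht.le) hM)
    have h2 := abs_le.1 (h1.trans hMδ)
    have h3 := hab u
    exact ⟨by linarith [h3.1, h2.1], by linarith [h3.2, h2.2]⟩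
  have hpos : ∀ t ∈ Metric.ball (0 : ℝ) δ, ∀ u, 0 < D t u := fun t ht u =>
    (half_pos ha).trans_le (hmem t ht u).1
  refine (hasDerivAt_integral_of_dominated_loc_of_lip (bound := fun _ => C * M)
    (Metric.ball_mem_nhds 0 hδ0) ?_ ?_ ?_ ?_ (integrable_const _) ?_).2
  · filter_upwards [Metric.ball_mem_nhds 0 hδ0] with t ht
    exact (continuous_comp_of_pos hΓ (hDc t) (hpos t ht)).aestronglyMeasurable
  · exact integrable_of_continuous (continuous_comp_of_pos hΓ (hDc 0) h0)
  · exact (continuous_comp_of_pos hΓ' (hDc 0) h0).aestronglyMeasurable.mul hm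
  · refine Eventually.of_forall fun u => ?_
    refine LipschitzOnWith.of_dist_le_mul fun t ht s hs => ?_
    rw [Real.coe_nnabs, abs_of_nonneg (by positivity), Real.dist_eq, Real.dist_eq]
    have h1 : ‖Γ (D t u) u - Γ (D s u) u‖ ≤ C * ‖D t u - D s u‖ :=
      (convex_Icc (a / 2) (b + a)).norm_image_sub_le_of_norm_hasDerivWithin_le
        (f := fun x => Γ x u) (f' := fun x => Γ' x u)
        (fun x hx => (hd x ((half_pos ha).trans_le hx.1) u).hasDerivWithinAt)
        (fun x hx => hC x hx u) (hmem s hs u) (hmem t ht u)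
    refine h1.trans ?_
    rw [mul_assoc]
    exact mul_le_mul_of_nonneg_left (hL t s u) hC0
  · filter_upwards [hD'] with u hu
    exact (hd _ (h0 u) u).comp 0 hu

/-- A multiplier rule for an inequality constraint. An element k of ker A becomes strictly
admissible after subtracting εr, so B k ≥ 0; applied to -k as well, this shows that B vanishes on
ker A and is a multiple of A. -/
theorem linear_multiplier {M : Type*} [AddCommGroup M] [Module ℝ M] (A B : M →ₗ[ℝ] ℝ) {r : M}
    (hr : 0 < A r) (h : ∀ k, A k < 0 → 0 ≤ B k) (k : M) : B k = B r / A r * A k := by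
  have key : ∀ k, A k = 0 → 0 ≤ B k := by
    intro k hk
    by_contra! hB
    -- Chosen so that ε|B r| < -B k / 2, which makes B(k - εr) negative.
    set ε := -B k / (2 * (|B r| + 1)) with hε
    have hε0 : 0 < ε := div_pos (by linarith) (by positivity)
    have h1 := h (k - ε • r) (by simp [hk]; positivity)
    simp only [map_sub, map_smul, smul_eq_mul] at h1
    have h2 : ε * (|B r| + 1) = -B k / 2 := by rw [hε]; field_simp
    nlinarith [neg_abs_le (B r)]
  have h0 : A (k - (A k / A r) • r) = 0 := by
    simp only [map_sub, map_smul, smul_eq_mul]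
    field_simp
    ring
  have h1 := key _ h0
  have h2 := key (-(k - (A k / A r) • r)) (by rw [map_neg, h0, neg_zero])
  rw [map_neg] at h2
  have h3 : B (k - (A k / A r) • r) = 0 := by linarith
  simp only [map_sub, map_smul, smul_eq_mul] at h3
  rw [sub_eq_zero.1 h3]
  field_simp

theorem integrable_mul_argPolar [Nonempty (Sph n)] {r w k : Sph n → ℝ} (hr : Continuous r)
    (h0 : ∀ v, 0 < r v) (hw : Continuous w) (hk : Continuous k) :
    Integrable (fun u : Sph n => w u * (inner ℝ (u : E n) (argPolar r u : E n) *
      k (argPolar r u))) (sphMeasure n) := by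
  obtain ⟨B, hB⟩ := exists_abs_le hw
  obtain ⟨C, hC⟩ := exists_abs_le hk
  have hα := aemeasurable_argPolar hr h0
  have hm : AEMeasurable (fun u : Sph n => w u * (inner ℝ (u : E n) (argPolar r u : E n) *
      k (argPolar r u))) (sphMeasure n) :=
    hw.measurable.aemeasurable.mul ((measurable_subtype_coe.aemeasurable.inner
      (measurable_subtype_coe.comp_aemeasurable hα)).mul (hk.measurable.comp_aemeasurable hα))
  refine Integrable.of_bound hm.aestronglyMeasurable (B * C) (Eventually.of_forall fun u => ?_)
  rw [norm_mul, norm_mul]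
  have h1 := abs_inner_sph_le (u : E n) (argPolar r u)
  rw [norm_sph] at h1
  refine mul_le_mul (hB u) ?_ (by positivity) (by positivity)
  calc _ ≤ 1 * (C : ℝ) := mul_le_mul h1 (hC _) (abs_nonneg _) zero_le_one
    _ = C := one_mul _

/-- The Euler-Lagrange equation for minimizing `∫ F(r) dμ` under an upper bound on
`∫ Γ(polarFun r) du`. -/
theorem exists_multiplier [Nonempty (Sph n)] {μ : Measure (Sph n)} [IsFiniteMeasure μ]
    {Γ Γ' F F' : ℝ → Sph n → ℝ}
    (hΓ : ContinuousOn (fun p : ℝ × Sph n => Γ p.1 p.2) (Ioi 0 ×ˢ univ))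
    (hΓ' : ContinuousOn (fun p : ℝ × Sph n => Γ' p.1 p.2) (Ioi 0 ×ˢ univ))
    (hΓd : ∀ s > 0, ∀ u, HasDerivAt (fun s => Γ s u) (Γ' s u) s)
    (hF : ContinuousOn (fun p : ℝ × Sph n => F p.1 p.2) (Ioi 0 ×ˢ univ))
    (hF' : ContinuousOn (fun p : ℝ × Sph n => F' p.1 p.2) (Ioi 0 ×ˢ univ))
    (hFd : ∀ s > 0, ∀ u, HasDerivAt (fun s => F s u) (F' s u) s)
    (hpos : ∀ s > 0, ∀ u, 0 < Γ' s u)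
    {r : Sph n → ℝ} (hr : Continuous r) (h0 : ∀ v, 0 < r v)
    (hmin : ∀ s : Sph n → ℝ, Continuous s → (∀ v, 0 < s v) →
      ∫ u : Sph n, Γ (polarFun s u) u ∂(sphMeasure n) ≤
        ∫ u : Sph n, Γ (polarFun r u) u ∂(sphMeasure n) →
      ∫ v, F (r v) v ∂μ ≤ ∫ v, F (s v) v ∂μ) :
    ∃ l : ℝ, ∀ k : Sph n → ℝ, Continuous k → ∫ v, F' (r v) v * k v ∂μ =
      l * ∫ u : Sph n, Γ' (polarFun r u) u *
        (inner ℝ (u : E n) (argPolar r u : E n) * k (argPolar r u)) ∂(sphMeasure n) := by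
  have hNc : Continuous fun u : Sph n => polarFun r (u : E n) :=
    (continuous_polarFun hr).comp continuous_subtype_val
  have hw : Continuous fun u : Sph n => Γ' (polarFun r u) u :=
    continuous_comp_of_pos hΓ' hNc (polarFun_pos hr h0)
  have hw2 : Continuous fun v => F' (r v) v := continuous_comp_of_pos hF' hr h0
  have hi := fun k : C(Sph n, ℝ) => integrable_mul_argPolar hr h0 hw k.continuous
  have hi2 : ∀ k : C(Sph n, ℝ), Integrable (fun v => F' (r v) v * k v) μ := fun k =>
    integrable_of_continuous (hw2.mul k.continuous)
  -- A and B are the first variations at r, in direction k, of the constraint and of the objective.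
  let A : C(Sph n, ℝ) →ₗ[ℝ] ℝ :=
    { toFun := fun k => ∫ u : Sph n, Γ' (polarFun r u) u *
        (inner ℝ (u : E n) (argPolar r u : E n) * k (argPolar r u)) ∂(sphMeasure n)
      map_add' := fun k k' => by
        rw [← integral_add (hi k) (hi k')]
        congr 1
        ext u
        simp only [ContinuousMap.add_apply]
        ring
      map_smul' := fun c k => by
        rw [RingHom.id_apply, smul_eq_mul, ← integral_const_mul]
        congr 1
        ext u
        simp only [ContinuousMap.smul_apply, smul_eq_mul]
        ring }
  let B : C(Sph n, ℝ) →ₗ[ℝ] ℝ :=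
    { toFun := fun k => ∫ v, F' (r v) v * k v ∂μ
      map_add' := fun k k' => by
        rw [← integral_add (hi2 k) (hi2 k')]
        congr 1
        ext u
        simp only [ContinuousMap.add_apply]
        ring
      map_smul' := fun c k => by
        rw [RingHom.id_apply, smul_eq_mul, ← integral_const_mul]
        congr 1
        ext u
        simp only [ContinuousMap.smul_apply, smul_eq_mul]
        ring }
  -- In the direction r the factor ⟨u, α(u)⟩ r(α(u)) is `polarFun r u` itself, so the integrand is
  -- positive.
  have hAr : 0 < A ⟨r, hr⟩ := by
    have hc : Continuous fun u : Sph n => Γ' (polarFun r u) u * polarFun r (u : E n) := hw.mul hNc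
    have hp : ∀ u : Sph n, 0 < Γ' (polarFun r u) u * polarFun r (u : E n) := fun u =>
      mul_pos (hpos _ (polarFun_pos hr h0 u) u) (polarFun_pos hr h0 u)
    have he : A ⟨r, hr⟩ =
        ∫ u : Sph n, Γ' (polarFun r u) u * polarFun r (u : E n) ∂(sphMeasure n) := by
      refine integral_congr_ae (Eventually.of_forall fun u => ?_)
      simp only [ContinuousMap.coe_mk, argPolar_spec hr u]
    rw [he]
    exact hc.integral_pos_of_hasCompactSupport_nonneg_nonzero
      (HasCompactSupport.of_compactSpace _) (fun u => (hp u).le)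
      (hp (Classical.arbitrary (Sph n))).ne'
  -- If A k < 0, then r + tk is admissible for small t > 0, and minimality makes the right slope B k
  -- of the objective nonnegative.
  refine ⟨B ⟨r, hr⟩ / A ⟨r, hr⟩, fun k hk => linear_multiplier A B hAr (fun k hAk => ?_) ⟨k, hk⟩⟩
  obtain ⟨C, hC⟩ := exists_abs_le k.continuous
  have hLip : ∀ (t s : ℝ) (v : Sph n), |(r v + t * k v) - (r v + s * k v)| ≤ C * |t - s| := by
    intro t s v
    rw [show (r v + t * k v) - (r v + s * k v) = (t - s) * k v by ring, abs_mul, mul_comm]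
    exact mul_le_mul_of_nonneg_right (hC v) (abs_nonneg _)
  have hct : ∀ t : ℝ, Continuous fun v => r v + t * k v := fun t =>
    hr.add (continuous_const.mul k.continuous)
  have hα := aemeasurable_argPolar hr h0
  have hV : HasDerivAt (fun t => ∫ u : Sph n, Γ (polarFun (fun v => r v + t * k v) u) u
      ∂(sphMeasure n)) (A k) 0 := by
    have := hasDerivAt_integral_comp (ν := sphMeasure n) hΓ hΓ' hΓd
      (D := fun t (u : Sph n) => polarFun (fun v => r v + t * k v) (u : E n))
      (D' := fun u : Sph n => inner ℝ (u : E n) (argPolar r u : E n) * k (argPolar r u)) (M := C)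
      (fun t => (continuous_polarFun (hct t)).comp continuous_subtype_val)
      (fun t s u => abs_polarFun_sub_le (hct t) (hct s) (hLip t s) u)
      (by simpa using polarFun_pos hr h0)
      ((measurable_subtype_coe.aemeasurable.inner (measurable_subtype_coe.comp_aemeasurable hα)).mul
        (k.continuous.measurable.comp_aemeasurable hα)).aestronglyMeasurable
      ((ae_differentiableAt_polarFun hr).mono fun u hu =>
        hasDerivAt_polarFun hr h0 k.continuous hu)
    simp only [zero_mul, add_zero] at this
    exact this
  have hP : HasDerivAt (fun t => ∫ v, F (r v + t * k v) v ∂μ) (B k) 0 := by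
    have := hasDerivAt_integral_comp (ν := μ) hF hF' hFd
      (D := fun t v => r v + t * k v) (D' := k) (M := C) hct hLip (by simpa using h0)
      k.continuous.aestronglyMeasurable
      (Eventually.of_forall fun v => by
        simpa using ((hasDerivAt_id (0 : ℝ)).mul_const (k v)).const_add (r v))
    simp only [zero_mul, add_zero] at this
    exact this
  obtain ⟨a, b, ha, hab⟩ := exists_pos_le hr h0
  have hposev : ∀ᶠ t in 𝓝[>] (0 : ℝ), ∀ v, 0 < r v + t * k v := by
    have : ∀ᶠ t in 𝓝 (0 : ℝ), |t| * C < a := by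
      have h : Tendsto (fun t : ℝ => |t| * C) (𝓝 0) (𝓝 (|0| * C)) := by
        apply Continuous.tendsto; fun_prop
      rw [abs_zero, zero_mul] at h
      exact h.eventually_lt_const ha
    filter_upwards [nhdsWithin_le_nhds this] with t ht v
    have h1 : |t * k v| ≤ |t| * C := by
      rw [abs_mul]
      exact mul_le_mul_of_nonneg_left (hC v) (abs_nonneg t)
    linarith [neg_abs_le (t * k v), (hab v).1]
  have hVs : ∀ᶠ t in 𝓝[>] (0 : ℝ),
      slope (fun t => ∫ u : Sph n, Γ (polarFun (fun v => r v + t * k v) u) u ∂(sphMeasure n)) 0 t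
        < 0 :=
    (hasDerivAt_iff_tendsto_slope.1 hV).eventually_lt_const hAk
      |>.filter_mono (nhdsWithin_mono _ fun t ht => ne_of_gt ht)
  have hPs := (hasDerivAt_iff_tendsto_slope.1 hP).mono_left
    (nhdsWithin_mono (0 : ℝ) (s := Ioi 0) fun t ht => ne_of_gt ht)
  refine ge_of_tendsto hPs ?_
  filter_upwards [hposev, hVs, self_mem_nhdsWithin] with t ht hVt ht0
  rw [mem_Ioi] at ht0
  rw [slope_def_field, sub_zero, div_neg_iff] at hVt
  have h1 : ∫ u : Sph n, Γ (polarFun (fun v => r v + t * k v) u) u ∂(sphMeasure n) ≤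
      ∫ u : Sph n, Γ (polarFun r u) u ∂(sphMeasure n) := by
    rcases hVt with h | h
    · exact absurd ht0 (not_lt.2 h.2.le)
    · have := h.1.le
      simp only [zero_mul, add_zero] at this
      linarith
  have h2 := hmin _ (hct t) ht h1
  rw [slope_def_field, sub_zero]
  refine div_nonneg ?_ ht0.le
  simp only [zero_mul, add_zero]
  linarith

/-! ### Dual volume and a priori bounds -/

/-- The general dual volume `∫ G(ρ(u), u) du` of the Wulff shape of `f`. -/
def dualVol (G : ℝ → Sph n → ℝ) (f : Sph n → ℝ) : ℝ :=
  ∫ u : Sph n, G (polarFun (fun w => (f w)⁻¹) (u : E n))⁻¹ u ∂(sphMeasure n)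

theorem dualVol_hull [Nonempty (Sph n)] (G : ℝ → Sph n → ℝ) {f : Sph n → ℝ} (hf : Continuous f)
    (h0 : ∀ v, 0 < f v) : dualVol G (hull f) = dualVol G f := by
  unfold dualVol
  simp only [polarFun_inv_hull hf h0]

theorem measurableSet_cap (ε : ℝ) (v : Sph n) : MeasurableSet (cap ε v) :=
  (isClosed_le continuous_const (by fun_prop)).measurableSet

/-- The integral of ⟨u, v⟩₊ is continuous and positive in v, hence at least some m > 0 on the
compact sphere. Splitting at height δ gives m ≤ δ|μ| + μ(cap). -/
theorem exists_uniform_cap {μ : Measure (Sph n)} [IsFiniteMeasure μ] (hμ : NotConcentrated μ) :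
    ∃ δ > 0, ∀ v : Sph n, δ ≤ μ.real (cap δ v) := by
  rcases isEmpty_or_nonempty (Sph n) with h | h
  · exact ⟨1, one_pos, fun v => isEmptyElim v⟩
  have hc : Continuous fun v : Sph n => ∫ u : Sph n, max (inner ℝ (u : E n) (v : E n)) 0 ∂μ := by
    refine continuous_of_dominated (bound := fun _ => 1) (fun v => ?_) (fun v => ?_)
      (integrable_const _) (Eventually.of_forall fun u => by fun_prop)
    · exact Continuous.aestronglyMeasurable (by fun_prop)
    · refine Eventually.of_forall fun u => ?_
      have := abs_inner_sph_le (u : E n) v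
      rw [norm_sph] at this
      rw [Real.norm_of_nonneg (le_max_right _ _)]
      exact max_le ((le_abs_self _).trans this) zero_le_one
  obtain ⟨m, b, hm, hmb⟩ := exists_pos_le hc hμ
  -- With δ(1 + |μ|) = m, the same δ serves as the height of the cap and as the bound on its mass.
  refine ⟨m / (1 + μ.real univ), by positivity, fun v => ?_⟩
  set δ := m / (1 + μ.real univ) with hδ
  have hδ0 : 0 < δ := by positivity
  have h1 : ∫ u : Sph n, max (inner ℝ (u : E n) (v : E n)) 0 ∂μ ≤
      ∫ u : Sph n, (δ + (cap δ v).indicator (fun _ => (1 : ℝ)) u) ∂μ := by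
    refine integral_mono (integrable_of_continuous (by fun_prop))
      ((integrable_const _).add ((integrable_const _).indicator (measurableSet_cap _ _)))
      fun u => ?_
    have := (le_abs_self _).trans (abs_inner_sph_le (u : E n) v)
    rw [norm_sph] at this
    by_cases hu : u ∈ cap δ v
    · simp only [indicator_of_mem hu]
      exact max_le (by linarith) (by linarith)
    · simp only [indicator_of_notMem hu, add_zero]
      exact max_le (not_le.1 hu).le hδ0.le
  rw [integral_add (integrable_const _) ((integrable_const _).indicator (measurableSet_cap _ _)),
    integral_indicator (measurableSet_cap _ _)] at h1
  simp only [integral_const, smul_eq_mul, mul_one, measureReal_restrict_apply_univ] at h1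
  have h2 := (hmb v).1
  have h3 : δ * (1 + μ.real univ) = m := by rw [hδ]; field_simp
  linarith

theorem integrable_section {G : ℝ → Sph n → ℝ}
    (hG : ContinuousOn (fun p : ℝ × Sph n => G p.1 p.2) (Ioi 0 ×ˢ univ)) {t : ℝ} (ht : 0 < t) :
    Integrable (fun u => G t u) (sphMeasure n) :=
  integrable_of_continuous (continuous_comp_of_pos (D := fun _ => t) hG continuous_const
    fun _ => ht)

theorem continuous_dualVol_integrand [Nonempty (Sph n)] {G : ℝ → Sph n → ℝ}
    (hG : ContinuousOn (fun p : ℝ × Sph n => G p.1 p.2) (Ioi 0 ×ˢ univ)) {f : Sph n → ℝ}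
    (hf : Continuous f) (h0 : ∀ v, 0 < f v) :
    Continuous fun u : Sph n => G (polarFun (fun w => (f w)⁻¹) (u : E n))⁻¹ u :=
  continuous_comp_of_pos hG (continuous_inv_polarFun_inv hf h0) (inv_polarFun_inv_pos hf h0)

theorem integral_section_nonneg {G : ℝ → Sph n → ℝ}
    (hG : ContinuousOn (fun p : ℝ × Sph n => G p.1 p.2) (Ioi 0 ×ˢ univ))
    (hanti : ∀ u, AntitoneOn (fun t => G t u) (Ioi 0))
    (hinf : Tendsto (fun t => ∫ u, G t u ∂(sphMeasure n)) atTop (𝓝 0)) {t : ℝ} (ht : 0 < t) :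
    0 ≤ ∫ u, G t u ∂(sphMeasure n) := by
  refine le_of_tendsto hinf ?_
  filter_upwards [eventually_ge_atTop t] with s hs
  exact integral_mono (integrable_section hG (ht.trans_le hs)) (integrable_section hG ht)
    fun u => hanti u ht (ht.trans_le hs) hs

/-- If the Wulff shape of `f` is thin in a direction close to `v₀`, then its dual volume is at least
the contribution of the cap around `v₀`, up to a constant. -/
theorem integral_cap_le_dualVol [Nonempty (Sph n)] {G : ℝ → Sph n → ℝ}
    (hG : ContinuousOn (fun p : ℝ × Sph n => G p.1 p.2) (Ioi 0 ×ˢ univ))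
    (hanti : ∀ u, AntitoneOn (fun t => G t u) (Ioi 0))
    (hinf : Tendsto (fun t => ∫ u, G t u ∂(sphMeasure n)) atTop (𝓝 0))
    {f : Sph n → ℝ} (hf : Continuous f) (h0 : ∀ v, 0 < f v) {ε : ℝ} (hε : 0 < ε) {v v₀ : Sph n}
    (hv : dist v v₀ < ε / 2) :
    ∫ u in cap ε v₀, G (2 * f v / ε) u ∂(sphMeasure n) - ∫ u, |G 1 u| ∂(sphMeasure n) ≤
      dualVol G f := by
  have hcm := measurableSet_cap ε v₀
  have hcf : Continuous fun w => (f w)⁻¹ := hf.inv₀ fun v => (h0 v).ne'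
  have hint := integrable_of_continuous (ν := sphMeasure n) (continuous_dualVol_integrand hG hf h0)
  obtain ⟨T, hT⟩ := (isCompact_range (continuous_inv_polarFun_inv hf h0)).bddAbove
  -- S ≥ 1 bounds the radial function. Off the cap, where G may be negative, G(ρ) ≥ G(S); as ∫ G(S)
  -- ≥ 0 over the sphere, the loss there is at most the cap integral of G(S), hence at most ∫
  -- |G(1)|.
  set S := max T 1 with hS
  have hS1 : 1 ≤ S := le_max_right _ _
  have hS0 : 0 < S := one_pos.trans_le hS1
  have ht0 : 0 < 2 * f v / ε := by have := h0 v; positivity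
  have h1 : ∫ u in cap ε v₀, G (2 * f v / ε) u ∂(sphMeasure n) ≤
      ∫ u in cap ε v₀, G (polarFun (fun w => (f w)⁻¹) (u : E n))⁻¹ u ∂(sphMeasure n) := by
    refine setIntegral_mono_on (integrable_section hG ht0).integrableOn hint.integrableOn hcm
      fun u hu => ?_
    refine hanti u (inv_polarFun_inv_pos hf h0 u) ht0 ?_
    have h2 := inner_mul_le_polarFun hcf (u : E n) v
    -- Moving v₀ to v costs at most ε/2 in the inner product, so ρ(u) ≤ f(v)/⟨u, v⟩ ≤ 2f(v)/ε on the
    -- cap.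
    have h3 : ε / 2 ≤ inner ℝ (u : E n) (v : E n) := by
      have h4 : |inner ℝ ((v : E n) - (v₀ : E n)) (u : E n)| ≤ ‖(v : E n) - (v₀ : E n)‖ :=
        abs_inner_sph_le _ u
      rw [← dist_eq_norm, ← Subtype.dist_eq] at h4
      have h5 := (neg_abs_le (inner ℝ ((v : E n) - (v₀ : E n)) (u : E n)))
      have h6 : inner ℝ ((v : E n) - (v₀ : E n)) (u : E n) =
          inner ℝ (u : E n) (v : E n) - inner ℝ (u : E n) (v₀ : E n) := by
        rw [inner_sub_left, real_inner_comm, real_inner_comm (v₀ : E n)]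
      have h7 : ε ≤ inner ℝ (u : E n) (v₀ : E n) := hu
      linarith
    have h8 : ε / 2 * (f v)⁻¹ ≤ polarFun (fun w => (f w)⁻¹) (u : E n) :=
      (mul_le_mul_of_nonneg_right h3 (inv_pos.2 (h0 v)).le).trans h2
    have h9 := inv_anti₀ (mul_pos (half_pos hε) (inv_pos.2 (h0 v))) h8
    refine h9.trans (le_of_eq ?_)
    field_simp
  have h2 : ∫ u in (cap ε v₀)ᶜ, G S u ∂(sphMeasure n) ≤
      ∫ u in (cap ε v₀)ᶜ, G (polarFun (fun w => (f w)⁻¹) (u : E n))⁻¹ u ∂(sphMeasure n) := by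
    refine setIntegral_mono (integrable_section hG hS0).integrableOn hint.integrableOn
      fun u => ?_
    exact hanti u (inv_polarFun_inv_pos hf h0 u) hS0
      ((hT (mem_range_self u)).trans (le_max_left _ _))
  have h3 : ∫ u in cap ε v₀, G S u ∂(sphMeasure n) ≤ ∫ u, |G 1 u| ∂(sphMeasure n) := by
    refine le_trans (setIntegral_mono (integrable_section hG hS0).integrableOn
      (integrable_section hG one_pos).abs.integrableOn fun u => ?_)
      (setIntegral_le_integral (integrable_section hG one_pos).abs
        (Eventually.of_forall fun u => abs_nonneg _))
    exact (hanti u (mem_Ioi.2 one_pos) hS0 hS1).trans (le_abs_self _)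
  have h4 := integral_section_nonneg hG hanti hinf hS0
  rw [← integral_add_compl hcm (integrable_section hG hS0)] at h4
  unfold dualVol
  rw [← integral_add_compl hcm hint]
  linarith

/-- A small value f(v) forces ρ to be small on a cap and V to exceed c. The blow-up is assumed for
each cap separately; compactness of the sphere makes the bound uniform. -/
theorem exists_lower_bound [Nonempty (Sph n)] {G : ℝ → Sph n → ℝ}
    (hG : ContinuousOn (fun p : ℝ × Sph n => G p.1 p.2) (Ioi 0 ×ˢ univ))
    (hanti : ∀ u, AntitoneOn (fun t => G t u) (Ioi 0))
    (hinf : Tendsto (fun t => ∫ u, G t u ∂(sphMeasure n)) atTop (𝓝 0)) {ε : ℝ} (hε : 0 < ε)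
    (hcap : ∀ v, Tendsto (fun t => ∫ u in cap ε v, G t u ∂(sphMeasure n)) (𝓝[>] 0) atTop) (c : ℝ) :
    ∃ a > 0, ∀ f : Sph n → ℝ, Continuous f → (∀ v, 0 < f v) → dualVol G f ≤ c →
      ∀ v, a ≤ f v := by
  have key : ∃ a > 0, ∀ f : Sph n → ℝ, Continuous f → (∀ v, 0 < f v) → dualVol G f ≤ c →
      ∀ v ∈ (univ : Set (Sph n)), a ≤ f v := by
    refine isCompact_univ.induction_on
      (p := fun s => ∃ a > 0, ∀ f : Sph n → ℝ, Continuous f → (∀ v, 0 < f v) → dualVol G f ≤ c →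
        ∀ v ∈ s, a ≤ f v) ⟨1, one_pos, fun f _ _ _ v hv => absurd hv (notMem_empty v)⟩ ?_ ?_ ?_
    · rintro s t hst ⟨a, ha, h⟩
      exact ⟨a, ha, fun f hf h0 hc v hv => h f hf h0 hc v (hst hv)⟩
    · rintro s t ⟨a, ha, h⟩ ⟨b, hb, h'⟩
      refine ⟨min a b, lt_min ha hb, fun f hf h0 hc v hv => ?_⟩
      rcases hv with hv | hv
      · exact (min_le_left _ _).trans (h f hf h0 hc v hv)
      · exact (min_le_right _ _).trans (h' f hf h0 hc v hv)
    · intro v₀ _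
      have h1 := (hcap v₀).eventually_gt_atTop (c + ∫ u, |G 1 u| ∂(sphMeasure n))
      obtain ⟨δ, hδ, hδ'⟩ := mem_nhdsGT_iff_exists_Ioo_subset.1 h1
      rw [mem_Ioi] at hδ
      refine ⟨Metric.ball v₀ (ε / 2), nhdsWithin_le_nhds (Metric.ball_mem_nhds _ (half_pos hε)),
        ε * δ / 2, by positivity, fun f hf h0 hc v hv => ?_⟩
      by_contra! hlt
      have hfv := h0 v
      have h2 : 2 * f v / ε ∈ Ioo 0 δ := ⟨by positivity, by rw [div_lt_iff₀ hε]; linarith⟩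
      have h3 := hδ' h2
      have h4 := integral_cap_le_dualVol hG hanti hinf hf h0 hε (Metric.mem_ball.1 hv)
      simp only [mem_ofPred_eq] at h3
      linarith
  obtain ⟨a, ha, h⟩ := key
  exact ⟨a, ha, fun f hf h0 hc v => h f hf h0 hc v (mem_univ v)⟩

/-- If ρ(u) = M, then f ≥ M⟨u, ·⟩ ≥ δM on the cap around u, whose mass is at least δ, while φ(f) ≥
φ(a) elsewhere. For large M this makes ∫ φ(f) dμ positive. Only the hull is controlled: f itself may
have high peaks. -/
theorem exists_upper_bound [Nonempty (Sph n)] {μ : Measure (Sph n)} [IsFiniteMeasure μ]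
    (hμ : NotConcentrated μ) {φ : ℝ → ℝ} (hφ : ContinuousOn φ (Ioi 0))
    (hmono : MonotoneOn φ (Ioi 0)) (htop : Tendsto φ atTop atTop) {a : ℝ} (ha : 0 < a) :
    ∃ R, ∀ f : Sph n → ℝ, Continuous f → (∀ v, a ≤ f v) → ∫ v, φ (f v) ∂μ ≤ 0 →
      ∀ v, hull f v ≤ R := by
  obtain ⟨δ, hδ, hcap⟩ := exists_uniform_cap hμ
  -- The threshold is the condition φ(a)|μ| + δ(φ(δM) - φ(a)) > 0 solved for φ(δM).
  have hev : ∀ᶠ M : ℝ in atTop, a ≤ δ * M ∧ φ a - φ a * μ.real univ / δ < φ (δ * M) := by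
    have h1 : Tendsto (fun M : ℝ => δ * M) atTop atTop := tendsto_id.const_mul_atTop hδ
    exact (h1.eventually_ge_atTop a).and ((htop.comp h1).eventually_gt_atTop _)
  obtain ⟨R, hR⟩ := eventually_atTop.1 hev
  refine ⟨R, fun f hf haf hle => ?_⟩
  have h0 : ∀ v, 0 < f v := fun v => ha.trans_le (haf v)
  have hcf : Continuous fun w => (f w)⁻¹ := hf.inv₀ fun v => (h0 v).ne'
  refine polarFun_le_of_le (inv_polarFun_inv_pos hf h0) fun u => ?_
  by_contra! hlt
  set M := (polarFun (fun w => (f w)⁻¹) (u : E n))⁻¹ with hM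
  have hM0 : 0 < M := inv_polarFun_inv_pos hf h0 u
  obtain ⟨h1, h2⟩ := hR M hlt.le
  have hcapf : ∀ v ∈ cap δ u, φ (δ * M) ≤ φ (f v) := by
    intro v hv
    refine hmono (ha.trans_le h1) (h0 v) ?_
    have h3 := inner_mul_le_polarFun hcf (u : E n) v
    rw [← inv_inv (polarFun _ _), ← hM, ← div_eq_mul_inv, div_le_iff₀ (h0 v), inv_mul_eq_div,
      le_div_iff₀ hM0] at h3
    have h4 : δ ≤ inner ℝ (v : E n) (u : E n) := hv
    rw [real_inner_comm] at h4
    exact (mul_le_mul_of_nonneg_right h4 hM0.le).trans h3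
  have hint : Integrable (fun v => φ (f v)) μ :=
    integrable_of_continuous (hφ.comp_continuous hf h0)
  have hlow : ∫ v, (φ a + (cap δ u).indicator (fun _ => φ (δ * M) - φ a) v) ∂μ ≤
      ∫ v, φ (f v) ∂μ := by
    refine integral_mono
      ((integrable_const _).add ((integrable_const _).indicator (measurableSet_cap _ _))) hint
      fun v => ?_
    by_cases hv : v ∈ cap δ u
    · simp only [indicator_of_mem hv]
      linarith [hcapf v hv]
    · simp only [indicator_of_notMem hv, add_zero]
      exact hmono ha (h0 v) (haf v)
  rw [integral_add (integrable_const _) ((integrable_const _).indicator (measurableSet_cap _ _)),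
    integral_indicator (measurableSet_cap _ _)] at hlow
  simp only [integral_const, smul_eq_mul, measureReal_restrict_apply_univ] at hlow
  have h5 : 0 ≤ φ (δ * M) - φ a := sub_nonneg.2 (hmono ha (ha.trans_le h1) h1)
  have h6 := mul_le_mul_of_nonneg_right (hcap u) h5
  have h7 : -(φ a * μ.real univ) < δ * (φ (δ * M) - φ a) := by
    have := mul_lt_mul_of_pos_left h2 hδ
    have h8 : δ * (φ a - φ a * μ.real univ / δ) = δ * φ a - φ a * μ.real univ := by field_simp
    linarith
  linarith

theorem continuousOn_dualVol [Nonempty (Sph n)] {G : ℝ → Sph n → ℝ}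
    (hG : ContinuousOn (fun p : ℝ × Sph n => G p.1 p.2) (Ioi 0 ×ˢ univ)) {a R : ℝ} (ha : 0 < a) :
    ContinuousOn (fun f : BoundedContinuousFunction (Sph n) ℝ => dualVol G f)
      {f | ∀ v, a ≤ f v ∧ f v ≤ R} := by
  obtain ⟨C, -, hC⟩ := exists_abs_le_of_Icc hG ha R
  have hp : ∀ f ∈ {f : BoundedContinuousFunction (Sph n) ℝ | ∀ v, a ≤ f v ∧ f v ≤ R},
      ∀ v, 0 < f v := fun f hf v => ha.trans_le (hf v).1
  have hN : ∀ f ∈ {f : BoundedContinuousFunction (Sph n) ℝ | ∀ v, a ≤ f v ∧ f v ≤ R},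
      ∀ u : Sph n, (polarFun (fun w => (f w)⁻¹) (u : E n))⁻¹ ∈ Icc a R := by
    intro f hf u
    have hcf : Continuous fun w => (f w)⁻¹ := f.continuous.inv₀ fun v => (hp f hf v).ne'
    have h1 := polarFun_pos hcf (fun v => inv_pos.2 (hp f hf v)) u
    refine ⟨le_inv_of_le_inv₀ h1 (polarFun_le_of_le (fun v => inv_pos.2 (hp f hf v))
      (fun v => inv_anti₀ ha (hf v).1) u), ?_⟩
    refine (inv_anti₀ (inv_pos.2 (hp f hf u)) (le_polarFun_self hcf u)).trans ?_
    rw [inv_inv]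
    exact (hf u).2
  refine continuousOn_of_dominated (bound := fun _ => C) (fun f hf => ?_) (fun f hf => ?_)
    (integrable_const _) (Eventually.of_forall fun u => ?_)
  · exact (continuous_dualVol_integrand hG f.continuous (hp f hf)).aestronglyMeasurable
  · exact Eventually.of_forall fun u => hC _ (hN f hf u) u
  · have h1 : ContinuousOn (fun f : BoundedContinuousFunction (Sph n) ℝ =>
        polarFun (fun w => (f w)⁻¹) (u : E n)) {f | ∀ v, a ≤ f v ∧ f v ≤ R} := by
      -- On functions bounded below by a, inversion is Lipschitz with constant a⁻², and `polarFun`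
      -- does not expand the supremum norm.
      refine LipschitzOnWith.continuousOn (K := (a⁻¹ * a⁻¹).toNNReal)
        (LipschitzOnWith.of_dist_le_mul fun f hf g hg => ?_)
      rw [Real.coe_toNNReal _ (by positivity), Real.dist_eq]
      refine abs_polarFun_sub_le (f.continuous.inv₀ fun v => (hp f hf v).ne')
        (g.continuous.inv₀ fun v => (hp g hg v).ne') (fun v => ?_) u
      have hfv := hp f hf v
      have hgv := hp g hg v
      have h2 : (f v)⁻¹ - (g v)⁻¹ = (f v)⁻¹ * (g v)⁻¹ * (g v - f v) := by field_simp
      change |(f v)⁻¹ - (g v)⁻¹| ≤ _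
      rw [h2, abs_mul, abs_of_pos (by positivity), abs_sub_comm]
      exact mul_le_mul (mul_le_mul (inv_anti₀ ha (hf v).1) (inv_anti₀ ha (hg v).1)
        (by positivity) (by positivity)) (by simpa [Real.dist_eq] using f.dist_coe_le_dist v)
        (abs_nonneg _) (by positivity)
    have h2 : ContinuousOn (fun f : BoundedContinuousFunction (Sph n) ℝ =>
        ((polarFun (fun w => (f w)⁻¹) (u : E n))⁻¹, u)) {f | ∀ v, a ≤ f v ∧ f v ≤ R} :=
      (h1.inv₀ fun f hf => by
        have := ha.trans_le (hN f hf u).1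
        exact (inv_pos.1 this).ne').prodMk continuousOn_const
    exact hG.comp h2 fun f hf => ⟨ha.trans_le (hN f hf u).1, mem_univ _⟩

/-! ### Compactness and existence of a minimizer -/

/-- Support functions of bodies in the ball of radius R are R-Lipschitz, so this Arzelà–Ascoli class
contains all hulls that satisfy the bounds. -/
theorem isCompact_lipschitz_class (a R : ℝ) (hR : 0 ≤ R) :
    IsCompact {f : BoundedContinuousFunction (Sph n) ℝ |
      (∀ v, a ≤ f v ∧ f v ≤ R) ∧ ∀ v w, |f v - f w| ≤ R * dist v w} := by
  refine BoundedContinuousFunction.arzela_ascoli₂ (Icc a R) isCompact_Icc _ ?_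
    (fun f v hf => hf.1 v) ?_
  · simp only [ofPred_and, ofPred_forall]
    refine IsClosed.inter (isClosed_iInter fun v => ?_)
      (isClosed_iInter fun v => isClosed_iInter fun w => ?_)
    · exact (isClosed_le continuous_const (continuous_eval_const v)).inter
        (isClosed_le (continuous_eval_const v) continuous_const)
    · exact isClosed_le ((continuous_eval_const v).sub
        (continuous_eval_const w)).abs continuous_const
  · refine (LipschitzWith.uniformEquicontinuous _ R.toNNReal fun f =>
      LipschitzWith.of_dist_le_mul fun v w => ?_).equicontinuous
    rw [Real.coe_toNNReal _ hR, Real.dist_eq]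
    exact f.2.2 v w

/-- Existence of a solution of the minimization problem. -/
theorem exists_minimizer [Nonempty (Sph n)] {μ : Measure (Sph n)} [IsFiniteMeasure μ]
    (hμ : NotConcentrated μ) {G : ℝ → Sph n → ℝ}
    (hG : ContinuousOn (fun p : ℝ × Sph n => G p.1 p.2) (Ioi 0 ×ˢ univ))
    (hanti : ∀ u, AntitoneOn (fun t => G t u) (Ioi 0))
    (hinf : Tendsto (fun t => ∫ u, G t u ∂(sphMeasure n)) atTop (𝓝 0)) {ε : ℝ} (hε : 0 < ε)
    (hcap : ∀ v, Tendsto (fun t => ∫ u in cap ε v, G t u ∂(sphMeasure n)) (𝓝[>] 0) atTop)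
    {φ : ℝ → ℝ} (hφ : ContinuousOn φ (Ioi 0)) (hmono : MonotoneOn φ (Ioi 0))
    (htop : Tendsto φ atTop atTop) (h1 : φ 1 = 0) :
    ∃ f : Sph n → ℝ, Continuous f ∧ (∀ v, 0 < f v) ∧ (∀ v, hull f v = f v) ∧
      ∀ g : Sph n → ℝ, Continuous g → (∀ v, 0 < g v) → dualVol G g ≤ dualVol G f →
        ∫ v, φ (f v) ∂μ ≤ ∫ v, φ (g v) ∂μ := by
  -- The constraint level is that of the unit ball, an admissible competitor with objective φ(1)|μ|
  -- = 0; so only nonpositive objectives matter, as the upper bound requires.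
  set c := dualVol G fun _ => 1 with hc
  obtain ⟨a, ha, hlow⟩ := exists_lower_bound hG hanti hinf hε hcap c
  obtain ⟨R₀, hup⟩ := exists_upper_bound hμ hφ hmono htop ha
  set R := max R₀ 1 with hR
  have hR0 : 0 < R := one_pos.trans_le (le_max_right _ _)
  have ha1 : a ≤ 1 := by
    have v := Classical.arbitrary (Sph n)
    exact hlow (fun _ => 1) continuous_const (fun _ => one_pos) le_rfl v
  set A : Set (BoundedContinuousFunction (Sph n) ℝ) :=
    {f | (∀ v, a ≤ f v ∧ f v ≤ R) ∧ ∀ v w, |f v - f w| ≤ R * dist v w} with hA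
  have hAc : IsCompact A := isCompact_lipschitz_class a R hR0.le
  have hVA : ContinuousOn (fun f : BoundedContinuousFunction (Sph n) ℝ => dualVol G f) A :=
    (continuousOn_dualVol hG ha).mono fun f hf => hf.1
  have hBc : IsCompact (A ∩ (fun f : BoundedContinuousFunction (Sph n) ℝ => dualVol G f) ⁻¹'
      Iic c) :=
    hAc.of_isClosed_subset (hVA.preimage_isClosed_of_isClosed hAc.isClosed isClosed_Iic)
      inter_subset_left
  obtain ⟨C, hC⟩ := (isCompact_Icc (a := a) (b := R)).exists_bound_of_continuousOn
    (hφ.mono fun s hs => ha.trans_le hs.1)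
  have hΦ : ContinuousOn (fun f : BoundedContinuousFunction (Sph n) ℝ => ∫ v, φ (f v) ∂μ) A := by
    refine continuousOn_of_dominated (bound := fun _ => C) (fun f hf => ?_) (fun f hf => ?_)
      (integrable_const _) (Eventually.of_forall fun v => ?_)
    · exact (hφ.comp_continuous f.continuous
        fun v => ha.trans_le (hf.1 v).1).aestronglyMeasurable
    · exact Eventually.of_forall fun v => hC _ (hf.1 v)
    · exact hφ.comp (continuous_eval_const v).continuousOn
        fun f hf => ha.trans_le (hf.1 v).1
  have h1mem : BoundedContinuousFunction.const (Sph n) (1 : ℝ) ∈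
      A ∩ (fun f : BoundedContinuousFunction (Sph n) ℝ => dualVol G f) ⁻¹' Iic c := by
    refine ⟨⟨fun v => ⟨ha1, le_max_right _ _⟩, fun v w => ?_⟩, mem_preimage.2 (mem_Iic.2 (le_of_eq rfl))⟩
    simp only [BoundedContinuousFunction.const_apply, sub_self, abs_zero]
    positivity
  obtain ⟨f₁, hf₁, hmin⟩ := hBc.exists_isMinOn ⟨_, h1mem⟩ (hΦ.mono inter_subset_left)
  have hf₁0 : ∀ v, 0 < f₁ v := fun v => ha.trans_le (hf₁.1.1 v).1
  have hΦ1 : ∫ v, φ (f₁ v) ∂μ ≤ 0 := by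
    have := hmin h1mem
    simpa [h1] using this
  have hhull : ∀ g : Sph n → ℝ, Continuous g → (∀ v, 0 < g v) →
      ∫ v, φ (hull g v) ∂μ ≤ ∫ v, φ (g v) ∂μ := by
    intro g hg hg0
    refine integral_mono
      (integrable_of_continuous (hφ.comp_continuous (continuous_hull hg hg0) (hull_pos hg hg0)))
      (integrable_of_continuous (hφ.comp_continuous hg hg0)) fun v => ?_
    exact hmono (hull_pos hg hg0 v) (hg0 v) (hull_le hg hg0 v)
  -- The minimizer in the compact class is replaced by its hull. A rival with positive objective
  -- loses at once; any other is compared through its own hull, which lies in the class.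
  refine ⟨hull f₁, continuous_hull f₁.continuous hf₁0, hull_pos f₁.continuous hf₁0,
    hull_hull f₁.continuous hf₁0, fun g hg hg0 hgV => ?_⟩
  refine (hhull _ f₁.continuous hf₁0).trans ?_
  rw [dualVol_hull G f₁.continuous hf₁0] at hgV
  rcases le_or_gt (∫ v, φ (g v) ∂μ) 0 with hle | hgt
  swap
  · exact hΦ1.trans hgt.le
  refine le_trans ?_ (hhull g hg hg0)
  have hgc : dualVol G g ≤ c := hgV.trans hf₁.2
  have hag := hlow g hg hg0 hgc
  have hah := hlow (hull g) (continuous_hull hg hg0) (hull_pos hg hg0)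
    (by rwa [dualVol_hull G hg hg0])
  have hhR := fun v => (hup g hg hag hle v).trans (le_max_left R₀ 1)
  have hρR : ∀ u : Sph n, |(polarFun (fun w => (g w)⁻¹) (u : E n))⁻¹| ≤ R := fun u => by
    rw [abs_of_pos (inv_polarFun_inv_pos hg hg0 u)]
    exact (le_polarFun_self (continuous_inv_polarFun_inv hg hg0) u).trans (hhR u)
  have hLip : LipschitzWith R.toNNReal (hull g) := by
    have := lipschitzWith_polarFun (continuous_inv_polarFun_inv hg hg0) (B := R.toNNReal)
      (by rwa [Real.coe_toNNReal _ hR0.le])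
    have h2 := this.comp (LipschitzWith.subtype_val (Metric.sphere (0 : E n) 1))
    rw [mul_one] at h2
    exact h2
  refine hmin (a := BoundedContinuousFunction.mkOfCompact ⟨hull g, continuous_hull hg hg0⟩)
    ⟨⟨fun v => ⟨hah v, hhR v⟩, fun v w => ?_⟩, ?_⟩
  · have := hLip.dist_le_mul v w
    rwa [Real.coe_toNNReal _ hR0.le, Real.dist_eq] at this
  · exact (dualVol_hull G hg hg0).le.trans hgc

/-! ### From the Euler–Lagrange equation to an identity of measures -/

/-- A finite measure is determined by its integrals of continuous functions, so μ is the
push-forward of w dσ under α. As α is only almost everywhere measurable, the preimage of A is only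
null measurable. -/
theorem measureReal_eq_setIntegral_preimage {μ σ : Measure (Sph n)} [IsFiniteMeasure μ]
    {α : Sph n → Sph n} (hα : AEMeasurable α σ) {w : Sph n → ℝ} (hw : Integrable w σ)
    (hw0 : ∀ u, 0 ≤ w u)
    (h : ∀ g : Sph n → ℝ, Continuous g → ∫ v, g v ∂μ = ∫ u, w u * g (α u) ∂σ)
    {A : Set (Sph n)} (hA : MeasurableSet A) : μ.real A = ∫ u in α ⁻¹' A, w u ∂σ := by
  set ν := (σ.withDensity fun u => ENNReal.ofReal (w u)).map α with hν
  have hα' : AEMeasurable α (σ.withDensity fun u => ENNReal.ofReal (w u)) :=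
    hα.mono_ac (withDensity_absolutelyContinuous _ _)
  have hfin : IsFiniteMeasure (σ.withDensity fun u => ENNReal.ofReal (w u)) :=
    isFiniteMeasure_withDensity_ofReal hw.2
  have hνg : ∀ g : Sph n → ℝ, StronglyMeasurable g → ∫ v, g v ∂ν = ∫ u, w u * g (α u) ∂σ := by
    intro g hg
    rw [hν, integral_map hα' hg.aestronglyMeasurable,
      integral_withDensity_eq_integral_toReal_smul₀ hw.aemeasurable.ennreal_ofReal
        (Eventually.of_forall fun _ => ENNReal.ofReal_lt_top)]
    simp only [ENNReal.toReal_ofReal (hw0 _), smul_eq_mul]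
  have hμν : μ = ν := by
    refine ext_of_forall_integral_eq_of_IsFiniteMeasure fun g => ?_
    rw [h g g.continuous, hνg g g.continuous.stronglyMeasurable]
  have hnull : NullMeasurableSet (α ⁻¹' A) σ := hα.nullMeasurableSet_preimage hA
  rw [hμν, ← integral_indicator_one hA,
    hνg _ (stronglyMeasurable_one.indicator hA), ← integral_indicator₀ hnull]
  congr 1
  ext u
  by_cases hu : α u ∈ A
  · rw [indicator_of_mem hu, indicator_of_mem (mem_preimage.2 hu), Pi.one_apply, mul_one]
  · rw [indicator_of_notMem (s := A) hu, indicator_of_notMem (s := α ⁻¹' A) hu, mul_zero]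

/-- The divergence of ∫ ψ(s)/s ds is exactly the coercivity of the objective. -/
theorem tendsto_integral_div_atTop {ψ : ℝ → ℝ} (hψ : ContinuousOn ψ (Ioi 0))
    (hψ0 : ∀ t > 0, 0 < ψ t) (hint : ∫⁻ s in Ioi (1 : ℝ), ENNReal.ofReal (ψ s / s) = ⊤) :
    Tendsto (fun t => ∫ s in (1 : ℝ)..t, ψ s / s) atTop atTop := by
  have hc : ContinuousOn (fun s => ψ s / s) (Ioi 0) :=
    hψ.div continuousOn_id fun s hs => ne_of_gt hs
  have hcover : AECover (volume.restrict (Ioi (1 : ℝ))) atTop fun t : ℝ => Iic t :=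
    aecover_Iic tendsto_id
  have hm : AEMeasurable (fun s => ENNReal.ofReal (ψ s / s)) (volume.restrict (Ioi (1 : ℝ))) :=
    ((hc.mono (Ioi_subset_Ioi zero_le_one)).aemeasurable measurableSet_Ioi).ennreal_ofReal
  have h1 := hcover.lintegral_tendsto_of_countably_generated hm
  rw [hint] at h1
  have h2 : ∀ᶠ t in atTop, (∫⁻ s in Iic t, ENNReal.ofReal (ψ s / s)
      ∂(volume.restrict (Ioi (1 : ℝ)))) = ENNReal.ofReal (∫ s in (1 : ℝ)..t, ψ s / s) := by
    filter_upwards [eventually_ge_atTop 1] with t ht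
    rw [Measure.restrict_restrict measurableSet_Iic, Iic_inter_Ioi,
      intervalIntegral.integral_of_le ht, ofReal_integral_eq_lintegral_ofReal]
    · exact (intervalIntegrable_iff_integrableOn_Ioc_of_le ht).1
        (ContinuousOn.intervalIntegrable (hc.mono fun s hs => by
          rw [uIcc_of_le ht] at hs
          exact one_pos.trans_le hs.1))
    · filter_upwards [ae_restrict_mem measurableSet_Ioc] with s hs
      have : 0 < s := one_pos.trans hs.1
      exact (div_pos (hψ0 s this) this).le
  exact ENNReal.tendsto_ofReal_nhds_top.1 (h1.congr' h2)

theorem hasDerivAt_integral_div {ψ : ℝ → ℝ} (hψ : ContinuousOn ψ (Ioi 0)) {t : ℝ} (ht : 0 < t) :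
    HasDerivAt (fun t => ∫ s in (1 : ℝ)..t, ψ s / s) (ψ t / t) t := by
  have hc : ContinuousOn (fun s => ψ s / s) (Ioi 0) :=
    hψ.div continuousOn_id fun s hs => ne_of_gt hs
  refine intervalIntegral.integral_hasDerivAt_right ?_ ?_ (hc.continuousAt (Ioi_mem_nhds ht))
  · refine ContinuousOn.intervalIntegrable (hc.mono fun s hs => ?_)
    exact (lt_min one_pos ht).trans_le hs.1
  · exact hc.stronglyMeasurableAtFilter isOpen_Ioi t ht

/-- The solution of the general dual Orlicz Minkowski problem in terms of support functions. -/
theorem exists_supportFunction [Nonempty (Sph n)] {μ : Measure (Sph n)} [IsFiniteMeasure μ]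
    (hμ0 : μ ≠ 0) (hμ : NotConcentrated μ) {G : ℝ → Sph n → ℝ} {ψ : ℝ → ℝ} {ε : ℝ}
    (hG : ContinuousOn (fun p : ℝ × Sph n => G p.1 p.2) (Ioi 0 ×ˢ univ))
    (hGd : ∀ t > 0, ∀ u, DifferentiableAt ℝ (fun s => G s u) t)
    (hG' : ContinuousOn (fun p : ℝ × Sph n => partialT G p.1 p.2) (Ioi 0 ×ˢ univ))
    (hneg : ∀ t > 0, ∀ u, partialT G t u < 0) (hε : 0 < ε)
    (hcap : ∀ v, Tendsto (fun t => ∫ u in cap ε v, G t u ∂(sphMeasure n)) (𝓝[>] 0) atTop)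
    (hinf : Tendsto (fun t => ∫ u, G t u ∂(sphMeasure n)) atTop (𝓝 0))
    (hψ : ContinuousOn ψ (Ioi 0)) (hψ0 : ∀ t > 0, 0 < ψ t)
    (hint : ∫⁻ s in Ioi (1 : ℝ), ENNReal.ofReal (ψ s / s) = ⊤) :
    ∃ f : Sph n → ℝ, Continuous f ∧ (∀ v, 0 < f v) ∧ (∀ v, hull f v = f v) ∧
      ∃ l : ℝ, ∀ A : Set (Sph n), MeasurableSet A → μ.real A =
        l * ∫ u in argPolar (fun w => (f w)⁻¹) ⁻¹' A,
          (polarFun (fun w => (f w)⁻¹) (u : E n))⁻¹ *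
            partialT G (polarFun (fun w => (f w)⁻¹) (u : E n))⁻¹ u /
              ψ (f (argPolar (fun w => (f w)⁻¹) u)) ∂(sphMeasure n) := by
  set φ : ℝ → ℝ := fun t => ∫ s in (1 : ℝ)..t, ψ s / s with hφdef
  have hφd : ∀ t > 0, HasDerivAt φ (ψ t / t) t := fun t ht => hasDerivAt_integral_div hψ ht
  have hφc : ContinuousOn φ (Ioi 0) := fun t ht => (hφd t ht).continuousAt.continuousWithinAt
  have hmono : MonotoneOn φ (Ioi 0) := by
    refine monotoneOn_of_deriv_nonneg (convex_Ioi 0) hφc (fun t ht => ?_) fun t ht => ?_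
    · rw [interior_Ioi] at ht
      exact (hφd t ht).differentiableAt.differentiableWithinAt
    · rw [interior_Ioi] at ht
      rw [(hφd t ht).deriv]
      exact (div_pos (hψ0 t ht) ht).le
  have hanti : ∀ u, AntitoneOn (fun t => G t u) (Ioi 0) := by
    intro u
    refine antitoneOn_of_deriv_nonpos (convex_Ioi 0)
      (fun t ht => (hGd t ht u).continuousAt.continuousWithinAt) (fun t ht => ?_) fun t ht => ?_
    · rw [interior_Ioi] at ht
      exact (hGd t ht u).differentiableWithinAt
    · rw [interior_Ioi] at ht
      exact (hneg t ht u).le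
  obtain ⟨f, hf, h0, hhull, hmin⟩ := exists_minimizer hμ hG hanti hinf hε hcap hφc hmono
    (tendsto_integral_div_atTop hψ hψ0 hint) intervalIntegral.integral_same
  refine ⟨f, hf, h0, hhull, ?_⟩
  set r : Sph n → ℝ := fun w => (f w)⁻¹ with hr
  have hrc : Continuous r := hf.inv₀ fun v => (h0 v).ne'
  have hr0 : ∀ v, 0 < r v := fun v => inv_pos.2 (h0 v)
  have hinvc : ContinuousOn (fun p : ℝ × Sph n => (p.1⁻¹, p.2)) (Ioi 0 ×ˢ univ) :=
    (continuousOn_fst.inv₀ fun p hp => ne_of_gt hp.1).prodMk continuousOn_snd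
  have hinvm : MapsTo (fun p : ℝ × Sph n => (p.1⁻¹, p.2)) (Ioi 0 ×ˢ univ) (Ioi 0 ×ˢ univ) :=
    fun p hp => ⟨inv_pos.2 (mem_Ioi.1 hp.1), mem_univ _⟩
  have hinv1 : ContinuousOn (fun p : ℝ × Sph n => p.1⁻¹) (Ioi 0 ×ˢ univ) :=
    continuousOn_fst.inv₀ fun p hp => ne_of_gt hp.1
  have hinvm1 : MapsTo (fun p : ℝ × Sph n => p.1⁻¹) (Ioi 0 ×ˢ univ) (Ioi 0) :=
    fun p hp => inv_pos.2 (mem_Ioi.1 hp.1)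
  -- The problem is rewritten in r = 1/f, since the gauge is a supremum of terms linear in r. The
  -- derivative of G(1/s) is positive, as a product of two negative factors.
  obtain ⟨l, hl⟩ := exists_multiplier (μ := μ)
    (Γ := fun s u => G s⁻¹ u) (Γ' := fun s u => partialT G s⁻¹ u * (-(s ^ 2)⁻¹))
    (F := fun s _ => φ s⁻¹) (F' := fun s _ => ψ s⁻¹ / s⁻¹ * (-(s ^ 2)⁻¹))
    (hG.comp hinvc hinvm)
    ((hG'.comp hinvc hinvm).mul
      ((continuousOn_fst.pow 2).inv₀ fun p hp => pow_ne_zero 2 (ne_of_gt hp.1)).neg)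
    (fun s hs u => ((hGd s⁻¹ (inv_pos.2 hs) u).hasDerivAt).comp s (hasDerivAt_inv hs.ne'))
    (hφc.comp hinv1 hinvm1)
    (((hψ.comp hinv1 hinvm1).div hinv1 fun p hp => ne_of_gt (inv_pos.2 (mem_Ioi.1 hp.1))).mul
      ((continuousOn_fst.pow 2).inv₀ fun p hp => pow_ne_zero 2 (ne_of_gt hp.1)).neg)
    (fun s hs u => (hφd s⁻¹ (inv_pos.2 hs)).comp s (hasDerivAt_inv hs.ne'))
    (fun s hs u => mul_pos_of_neg_of_neg (hneg _ (inv_pos.2 hs) u)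
      (neg_neg_of_pos (by positivity)))
    hrc hr0 (fun s hs hs0 hle => by
      have := hmin (fun v => (s v)⁻¹) (hs.inv₀ fun v => (hs0 v).ne') (fun v => inv_pos.2 (hs0 v))
        (by simpa only [dualVol, inv_inv] using hle)
      simpa only [hr, inv_inv] using this)
  set α := argPolar r with hα
  have hαm : AEMeasurable α (sphMeasure n) := aemeasurable_argPolar hrc hr0
  have hNp : ∀ u : Sph n, 0 < polarFun r (u : E n) := polarFun_pos hrc hr0
  set w : Sph n → ℝ := fun u => (polarFun r (u : E n))⁻¹ * partialT G (polarFun r (u : E n))⁻¹ u /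
    ψ (f (α u)) with hw
  have hψf : Continuous fun v => ψ (f v) := hψ.comp_continuous hf h0
  have hwneg : ∀ u, w u < 0 := fun u =>
    div_neg_of_neg_of_pos (mul_neg_of_pos_of_neg (inv_pos.2 (hNp u))
      (hneg _ (inv_pos.2 (hNp u)) u)) (hψ0 _ (h0 _))
  have key : ∀ g : Sph n → ℝ, Continuous g →
      ∫ v, g v ∂μ = l * ∫ u, w u * g (α u) ∂(sphMeasure n) := by
    intro g hg
    -- F'(r) equals -fψ(f), so this test function turns the left side into ∫ g dμ; on the right, ⟨u,
    -- α⟩ = f(α)/ρ cancels the factor f(α).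
    have h1 := hl (fun v => -(g v / (f v * ψ (f v))))
      (hg.div (hf.mul hψf) fun v => (mul_pos (h0 v) (hψ0 _ (h0 v))).ne').neg
    have e1 : ∀ v, ψ (r v)⁻¹ / (r v)⁻¹ * (-(r v ^ 2)⁻¹) * -(g v / (f v * ψ (f v))) = g v := by
      intro v
      have h2 := h0 v
      have h3 := hψ0 _ h2
      simp only [hr, inv_inv]
      field_simp
    have e2 : ∀ u : Sph n, partialT G (polarFun r (u : E n))⁻¹ u * (-(polarFun r (u : E n) ^ 2)⁻¹) *
        (inner ℝ (u : E n) (α u : E n) * -(g (α u) / (f (α u) * ψ (f (α u))))) =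
        w u * g (α u) := by
      intro u
      have h2 := h0 (α u)
      have h3 := hψ0 _ h2
      have h4 := hNp u
      have h5 : inner ℝ (u : E n) (α u : E n) = polarFun r (u : E n) * f (α u) := by
        rw [← argPolar_spec hrc u, ← hα]
        simp only [hr]
        field_simp
      rw [h5, hw]
      field_simp
    simp only [e1, e2] at h1
    exact h1
  have hwint : Integrable w (sphMeasure n) := by
    have hρc : Continuous fun u : Sph n => (polarFun r (u : E n))⁻¹ :=
      continuous_inv_polarFun_inv hf h0
    have h1 : Continuous fun u : Sph n =>
        (polarFun r (u : E n))⁻¹ * partialT G (polarFun r (u : E n))⁻¹ u :=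
      hρc.mul (continuous_comp_of_pos hG' hρc fun u => inv_pos.2 (hNp u))
    have h2 : Continuous fun v => (ψ (f v))⁻¹ := hψf.inv₀ fun v => (hψ0 _ (h0 v)).ne'
    obtain ⟨B, hB⟩ := exists_abs_le h1
    obtain ⟨C, hC⟩ := exists_abs_le h2
    refine Integrable.of_bound (C := B * C) (h1.measurable.aemeasurable.mul
      (h2.measurable.comp_aemeasurable hαm)).aestronglyMeasurable (Eventually.of_forall fun u => ?_)
    rw [show w u = _ * _ from div_eq_mul_inv _ _, norm_mul]
    exact mul_le_mul (hB u) (hC (α u)) (norm_nonneg _) B.2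
  -- Testing with g = 1 gives |μ| = l ∫ w with w < 0; thus the density l·w is nonnegative.
  have hl0 : l ≤ 0 := by
    by_contra! hlt
    have h1 := key (fun _ => 1) continuous_const
    simp only [integral_const, smul_eq_mul, mul_one] at h1
    have h2 : ∫ u, w u ∂(sphMeasure n) ≤ 0 := integral_nonpos fun u => (hwneg u).le
    have h3 : 0 < μ.real univ := by
      have : NeZero μ := ⟨hμ0⟩
      exact measureReal_univ_pos
    nlinarith
  refine ⟨l, fun A hA => ?_⟩
  rw [← integral_const_mul]
  refine measureReal_eq_setIntegral_preimage hαm (hwint.const_mul l)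
    (fun u => mul_nonneg_of_nonpos_of_nonpos hl0 (hwneg u).le) (fun g hg => ?_) hA
  rw [key g hg, ← integral_const_mul]
  simp only [mul_assoc]

/-! ### Wulff shapes as convex bodies and their radial Gauss maps -/

theorem exists_pos_smul_sph {x : E n} (hx : x ≠ 0) : ∃ u : Sph n, x = ‖x‖ • (u : E n) := by
  refine ⟨⟨‖x‖⁻¹ • x, ?_⟩, ?_⟩
  · rw [mem_sphere_zero_iff_norm, norm_smul, norm_inv, norm_norm,
      inv_mul_cancel₀ (norm_ne_zero_iff.2 hx)]
  · rw [smul_inv_smul₀ (norm_ne_zero_iff.2 hx)]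

/-- The Wulff shape of `f`. -/
def wulffSet (f : Sph n → ℝ) : Set (E n) := {x | ∀ v : Sph n, inner ℝ x (v : E n) ≤ f v}

section wulff

variable [Nonempty (Sph n)] {f : Sph n → ℝ}

theorem mem_wulffSet_iff (hf : Continuous f) (h0 : ∀ v, 0 < f v) (x : E n) :
    x ∈ wulffSet f ↔ polarFun (fun w => (f w)⁻¹) x ≤ 1 := by
  have hc : Continuous fun w => (f w)⁻¹ := hf.inv₀ fun v => (h0 v).ne'
  refine ⟨fun h => polarFun_le fun v => ?_, fun h v => ?_⟩
  · rw [← div_eq_mul_inv, div_le_one (h0 v)]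
    exact h v
  · have := (inner_mul_le_polarFun hc x v).trans h
    rwa [← div_eq_mul_inv, div_le_one (h0 v)] at this

/-- The Wulff shape of `f` as a convex body. -/
def wulffBody (hf : Continuous f) (h0 : ∀ v, 0 < f v) : ConvexBody (E n) where
  carrier := wulffSet f
  convex' := by
    intro x hx y hy a b ha hb hab v
    rw [inner_add_left, real_inner_smul_left, real_inner_smul_left]
    have h1 := mul_le_mul_of_nonneg_left (hx v) ha
    have h2 := mul_le_mul_of_nonneg_left (hy v) hb
    calc _ ≤ a * f v + b * f v := add_le_add h1 h2
      _ = f v := by rw [← add_mul, hab, one_mul]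
  isCompact' := by
    refine Metric.isCompact_of_isClosed_isBounded ?_ ?_
    · simp only [wulffSet, ofPred_forall]
      exact isClosed_iInter fun v => isClosed_le (by fun_prop) continuous_const
    · obtain ⟨B, hB⟩ := exists_abs_le hf
      refine (Metric.isBounded_closedBall (x := (0 : E n)) (r := B)).subset fun x hx => ?_
      rw [mem_closedBall_zero_iff]
      rcases eq_or_ne x 0 with rfl | hx0
      · simp
      obtain ⟨u, hu⟩ := exists_pos_smul_sph hx0
      have h1 := hx u
      rw [hu, real_inner_smul_left, inner_sph_self, mul_one] at h1
      exact h1.trans ((le_abs_self _).trans (hB u))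
  nonempty' := ⟨0, fun v => by rw [inner_zero_left]; exact (h0 v).le⟩

theorem isKo_wulffBody (hf : Continuous f) (h0 : ∀ v, 0 < f v) : IsKo (wulffBody hf h0) := by
  have hc : Continuous fun w => (f w)⁻¹ := hf.inv₀ fun v => (h0 v).ne'
  refine mem_interior.2 ⟨{x | polarFun (fun w => (f w)⁻¹) x < 1}, fun x hx => ?_,
    isOpen_lt (continuous_polarFun hc) continuous_const, ?_⟩
  · exact (mem_wulffSet_iff hf h0 x).2 (le_of_lt hx)
  · rw [mem_ofPred_eq, polarFun_zero hc]
    exact one_pos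

theorem radFun_wulffSet (hf : Continuous f) (h0 : ∀ v, 0 < f v) (u : Sph n) :
    radFun (wulffSet f) (u : E n) = (polarFun (fun w => (f w)⁻¹) (u : E n))⁻¹ := by
  have hc : Continuous fun w => (f w)⁻¹ := hf.inv₀ fun v => (h0 v).ne'
  have hN := polarFun_pos hc (fun v => inv_pos.2 (h0 v)) u
  have : {r : ℝ | 0 < r ∧ r • (u : E n) ∈ wulffSet f} =
      Ioc 0 (polarFun (fun w => (f w)⁻¹) (u : E n))⁻¹ := by
    ext r
    refine and_congr_right fun hr => ?_
    rw [mem_wulffSet_iff hf h0, polarFun_smul hc hr.le, ← one_div, le_div_iff₀ hN]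
  rw [radFun, this, csSup_Ioc (inv_pos.2 hN)]

theorem inv_polarFun_smul_mem_wulffSet (hf : Continuous f) (h0 : ∀ v, 0 < f v) (u : Sph n) :
    (polarFun (fun w => (f w)⁻¹) (u : E n))⁻¹ • (u : E n) ∈ wulffSet f := by
  have hc : Continuous fun w => (f w)⁻¹ := hf.inv₀ fun v => (h0 v).ne'
  have hN := polarFun_pos hc (fun v => inv_pos.2 (h0 v)) u
  rw [mem_wulffSet_iff hf h0, polarFun_smul hc (inv_pos.2 hN).le, inv_mul_cancel₀ hN.ne']

/-- `hull f v` is the maximum of ⟨·, v⟩ over the boundary points ρ(u)u, so a fixed point of `hull`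
is the support function of its Wulff shape. -/
theorem suppFun_wulffSet (hf : Continuous f) (h0 : ∀ v, 0 < f v) (hh : ∀ v, hull f v = f v)
    (v : Sph n) : suppFun (wulffSet f) (v : E n) = f v := by
  refine IsGreatest.csSup_eq ⟨?_, ?_⟩
  · obtain ⟨u, hu⟩ := exists_polarFun_eq (continuous_inv_polarFun_inv hf h0) (v : E n)
    refine ⟨_, inv_polarFun_smul_mem_wulffSet hf h0 u, ?_⟩
    simp only [real_inner_smul_right]
    rw [mul_comm, hu]
    exact hh v
  · rintro _ ⟨x, hx, rfl⟩
    simp only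
    rw [real_inner_comm]
    exact hx v

/-- Links geometry and variation: v is a normal at ρ(u)u exactly when v attains the maximum defining
the gauge at u. -/
theorem smul_mem_suppPlane_iff (hf : Continuous f) (h0 : ∀ v, 0 < f v) (hh : ∀ v, hull f v = f v)
    (u v : Sph n) :
    (polarFun (fun w => (f w)⁻¹) (u : E n))⁻¹ • (u : E n) ∈ suppPlane (wulffSet f) (v : E n) ↔
      inner ℝ (u : E n) (v : E n) * (f v)⁻¹ = polarFun (fun w => (f w)⁻¹) (u : E n) := by
  have hc : Continuous fun w => (f w)⁻¹ := hf.inv₀ fun v => (h0 v).ne'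
  have hN := polarFun_pos hc (fun v => inv_pos.2 (h0 v)) u
  rw [suppPlane, mem_ofPred_eq, suppFun_wulffSet hf h0 hh, real_inner_smul_left, inv_mul_eq_div,
    div_eq_iff hN.ne', ← div_eq_mul_inv, div_eq_iff (h0 v).ne', mul_comm (f v)]

theorem polarFun_eq_one_of_mem_frontier (hf : Continuous f) (h0 : ∀ v, 0 < f v) {x : E n}
    (hx : x ∈ frontier (wulffSet f)) : polarFun (fun w => (f w)⁻¹) x = 1 := by
  have hc : Continuous fun w => (f w)⁻¹ := hf.inv₀ fun v => (h0 v).ne'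
  have hset : wulffSet f = {x | polarFun (fun w => (f w)⁻¹) x ≤ 1} :=
    Set.ext fun x => mem_wulffSet_iff hf h0 x
  rw [hset] at hx
  exact frontier_le_subset_eq (continuous_polarFun hc) continuous_const hx

theorem smul_mem_frontier (hf : Continuous f) (h0 : ∀ v, 0 < f v) (u : Sph n) :
    (polarFun (fun w => (f w)⁻¹) (u : E n))⁻¹ • (u : E n) ∈ frontier (wulffSet f) := by
  have hc : Continuous fun w => (f w)⁻¹ := hf.inv₀ fun v => (h0 v).ne'
  have hN := polarFun_pos hc (fun v => inv_pos.2 (h0 v)) u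
  rw [frontier_eq_closure_inter_closure]
  refine ⟨subset_closure (inv_polarFun_smul_mem_wulffSet hf h0 u), ?_⟩
  have hlim : Tendsto (fun t : ℝ => t • (u : E n))
      (𝓝[>] (polarFun (fun w => (f w)⁻¹) (u : E n))⁻¹)
      (𝓝 ((polarFun (fun w => (f w)⁻¹) (u : E n))⁻¹ • (u : E n))) :=
    ((continuous_id.smul continuous_const).tendsto _).mono_left nhdsWithin_le_nhds
  refine mem_closure_of_tendsto hlim ?_
  filter_upwards [self_mem_nhdsWithin] with t ht hmem
  rw [mem_Ioi] at ht
  rw [mem_wulffSet_iff hf h0, polarFun_smul hc ((inv_pos.2 hN).trans ht).le] at hmem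
  have := mul_lt_mul_of_pos_right ht hN
  rw [inv_mul_cancel₀ hN.ne'] at this
  linarith

theorem radGauss_wulffSet (hf : Continuous f) (h0 : ∀ v, 0 < f v) (hh : ∀ v, hull f v = f v)
    {u : Sph n} (hu : DifferentiableAt ℝ (polarFun fun w => (f w)⁻¹) (u : E n)) :
    radGauss (wulffSet f) u = argPolar (fun w => (f w)⁻¹) u := by
  have hc : Continuous fun w => (f w)⁻¹ := hf.inv₀ fun v => (h0 v).ne'
  have hset : radGaussSet (wulffSet f) {u} = {argPolar (fun w => (f w)⁻¹) u} := by
    ext v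
    simp only [radGaussSet, normalSet, image_singleton, mem_singleton_iff, exists_eq_left,
      mem_ofPred_eq]
    rw [radFun_wulffSet hf h0, smul_mem_suppPlane_iff hf h0 hh]
    refine ⟨fun h => ?_, fun h => ?_⟩
    · exact eq_of_polarFun_eq hc (fun v => inv_pos.2 (h0 v)) hu h (argPolar_spec hc u)
    · rw [h]
      exact argPolar_spec hc u
  have hex : ∃ v, radGaussSet (wulffSet f) {u} = {v} := ⟨_, hset⟩
  rw [radGauss, dif_pos hex]
  exact (singleton_injective (hset.symm.trans hex.choose_spec)).symm

theorem mem_revRadGaussSet_iff (hf : Continuous f) (h0 : ∀ v, 0 < f v) (hh : ∀ v, hull f v = f v)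
    {u : Sph n} (hu : DifferentiableAt ℝ (polarFun fun w => (f w)⁻¹) (u : E n))
    (A : Set (Sph n)) :
    u ∈ revRadGaussSet (wulffSet f) A ↔ argPolar (fun w => (f w)⁻¹) u ∈ A := by
  have hc : Continuous fun w => (f w)⁻¹ := hf.inv₀ fun v => (h0 v).ne'
  have hN := polarFun_pos hc (fun v => inv_pos.2 (h0 v)) u
  constructor
  · rintro ⟨v, hv, x, ⟨hxf, hxs⟩, hux⟩
    have hx1 := polarFun_eq_one_of_mem_frontier hf h0 hxf
    have hx0 : x ≠ 0 := by
      rintro rfl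
      rw [polarFun_zero hc] at hx1
      exact zero_ne_one hx1
    have hx : x = ‖x‖ • (u : E n) := by rw [hux, smul_inv_smul₀ (norm_ne_zero_iff.2 hx0)]
    have hnx : ‖x‖ = (polarFun (fun w => (f w)⁻¹) (u : E n))⁻¹ := by
      rw [hx, polarFun_smul hc (norm_nonneg x)] at hx1
      exact eq_inv_of_mul_eq_one_left hx1
    rw [hx, hnx, smul_mem_suppPlane_iff hf h0 hh] at hxs
    rwa [eq_of_polarFun_eq hc (fun v => inv_pos.2 (h0 v)) hu (argPolar_spec hc u) hxs]
  · intro h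
    refine ⟨_, h, _, ⟨smul_mem_frontier hf h0 u,
      (smul_mem_suppPlane_iff hf h0 hh u _).2 (argPolar_spec hc u)⟩, ?_⟩
    rw [norm_smul, norm_sph, mul_one, Real.norm_of_nonneg (inv_pos.2 hN).le, inv_inv,
      smul_inv_smul₀ hN.ne']

/-- At points of differentiability of the gauge, α_K is `argPolar` and the reverse radial Gauss
image is its preimage; the remaining directions form a null set. -/
theorem setIntegral_revRadGaussSet (hf : Continuous f) (h0 : ∀ v, 0 < f v)
    (hh : ∀ v, hull f v = f v) (F : ℝ → ℝ → Sph n → ℝ) (A : Set (Sph n)) :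
    ∫ u : Sph n in revRadGaussSet (wulffSet f) A, F (radFun (wulffSet f) (u : E n))
      (suppFun (wulffSet f) (radGauss (wulffSet f) u : E n)) u ∂(sphMeasure n) =
    ∫ u : Sph n in argPolar (fun w => (f w)⁻¹) ⁻¹' A,
      F (polarFun (fun w => (f w)⁻¹) (u : E n))⁻¹ (f (argPolar (fun w => (f w)⁻¹) u)) u
        ∂(sphMeasure n) := by
  have hae := ae_differentiableAt_polarFun (n := n)
    (r := fun w => (f w)⁻¹) (hf.inv₀ fun v => (h0 v).ne')
  have hset : revRadGaussSet (wulffSet f) A =ᵐ[sphMeasure n]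
      argPolar (fun w => (f w)⁻¹) ⁻¹' A := by
    filter_upwards [hae] with u hu
    exact propext (mem_revRadGaussSet_iff hf h0 hh hu A)
  rw [Measure.restrict_congr_set hset]
  refine integral_congr_ae (ae_restrict_of_ae ?_)
  filter_upwards [hae] with u hu
  rw [radFun_wulffSet hf h0, radGauss_wulffSet hf h0 hh hu, suppFun_wulffSet hf h0 hh]

end wulff

/-! ### Homogeneity under dilations and the power case -/

section scaling

variable [Nonempty (Sph n)]

theorem polarFun_const_mul {r : Sph n → ℝ} (hr : Continuous r) {c : ℝ} (hc : 0 ≤ c) (x : E n) :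
    polarFun (fun v => c * r v) x = c * polarFun r x := by
  rw [← polarFun_smul hr hc]
  unfold polarFun
  congr 1
  ext v
  rw [real_inner_smul_left]
  ring

theorem argPolar_const_mul {r : Sph n → ℝ} (hr : Continuous r) {c : ℝ} (hc : 0 < c) :
    argPolar (fun v => c * r v) = argPolar r := by
  ext1 u
  unfold argPolar
  congr 1
  ext v
  rw [polarFun_const_mul hr hc.le, mul_left_comm]
  exact mul_right_inj' hc.ne'

theorem hull_const_mul {f : Sph n → ℝ} (hf : Continuous f) (h0 : ∀ v, 0 < f v) {c : ℝ}
    (hc : 0 < c) (v : Sph n) : hull (fun v => c * f v) v = c * hull f v := by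
  have hcf : Continuous fun w => (f w)⁻¹ := hf.inv₀ fun v => (h0 v).ne'
  unfold hull
  rw [← polarFun_const_mul (continuous_inv_polarFun_inv hf h0) hc.le]
  congr 1
  ext u
  simp only [mul_inv]
  rw [polarFun_const_mul hcf (inv_pos.2 hc).le, mul_inv, inv_inv]

end scaling

theorem setIntegral_cap_pos {w : Sph n → ℝ} (hw : Continuous w) (hw0 : ∀ u, 0 < w u) {ε : ℝ}
    (hε : ε < 1) (v : Sph n) : 0 < ∫ u in cap ε v, w u ∂(sphMeasure n) := by
  rw [setIntegral_pos_iff_support_of_nonneg_ae (Eventually.of_forall fun u => (hw0 u).le)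
    (integrable_of_continuous hw).integrableOn]
  have hsupp : Function.support w = univ := Set.ext fun u => by simp [(hw0 u).ne']
  rw [hsupp, univ_inter]
  have hopen : IsOpen {u : Sph n | ε < inner ℝ (u : E n) (v : E n)} :=
    isOpen_lt continuous_const (by fun_prop)
  refine (hopen.measure_pos (sphMeasure n) ⟨v, ?_⟩).trans_le (measure_mono fun u hu => ?_)
  · rw [mem_ofPred_eq, inner_sph_self]
    exact hε
  · exact le_of_lt (mem_ofPred_eq ▸ hu)

theorem lintegral_rpow_div_eq_top {p : ℝ} (hp : 0 < p) :
    ∫⁻ s in Ioi (1 : ℝ), ENNReal.ofReal (s ^ p / s) = ⊤ := by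
  have heq : EqOn (fun s : ℝ => s ^ p / s) (fun s => s ^ (p - 1)) (Ioi 1) := fun s hs => by
    have : (0 : ℝ) < s := one_pos.trans hs
    exact (Real.rpow_sub_one this.ne' p).symm
  by_contra hne
  have hm : AEStronglyMeasurable (fun s : ℝ => s ^ p / s) (volume.restrict (Ioi 1)) := by
    have : Measurable fun s : ℝ => s ^ p / s := by fun_prop
    exact this.aestronglyMeasurable
  have h0 : 0 ≤ᵐ[volume.restrict (Ioi (1 : ℝ))] fun s : ℝ => s ^ p / s := by
    filter_upwards [ae_restrict_mem measurableSet_Ioi] with s hs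
    have : (0 : ℝ) < s := one_pos.trans hs
    simp only [Pi.zero_apply]
    positivity
  have h1 : IntegrableOn (fun s : ℝ => s ^ p / s) (Ioi 1) :=
    (lintegral_ofReal_ne_top_iff_integrable hm h0).1 hne
  rw [integrableOn_congr_fun heq measurableSet_Ioi, integrableOn_Ioi_rpow_iff one_pos] at h1
  linarith

theorem curvMeasure_wulffSet [Nonempty (Sph n)] {f : Sph n → ℝ} (hf : Continuous f)
    (h0 : ∀ v, 0 < f v) (hh : ∀ v, hull f v = f v) (G : ℝ → Sph n → ℝ) (ψ : ℝ → ℝ)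
    (A : Set (Sph n)) :
    curvMeasure G ψ (wulffSet f) A = (1 / (n : ℝ)) *
      ∫ u in argPolar (fun w => (f w)⁻¹) ⁻¹' A, (polarFun (fun w => (f w)⁻¹) (u : E n))⁻¹ *
        partialT G (polarFun (fun w => (f w)⁻¹) (u : E n))⁻¹ u /
          ψ (f (argPolar (fun w => (f w)⁻¹) u)) ∂(sphMeasure n) := by
  rw [curvMeasure, setIntegral_revRadGaussSet hf h0 hh fun ρ h u => ρ * partialT G ρ u / ψ h]

theorem pqCurvMeasure_wulffSet [Nonempty (Sph n)] {f : Sph n → ℝ} (hf : Continuous f)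
    (h0 : ∀ v, 0 < f v) (hh : ∀ v, hull f v = f v) (p q : ℝ) (Q : Set (E n)) (A : Set (Sph n)) :
    pqCurvMeasure p q (wulffSet f) Q A = (1 / (n : ℝ)) *
      ∫ u in argPolar (fun w => (f w)⁻¹) ⁻¹' A, f (argPolar (fun w => (f w)⁻¹) u) ^ (-p) *
        (polarFun (fun w => (f w)⁻¹) (u : E n))⁻¹ ^ q * radFun Q u ^ ((n : ℝ) - q)
          ∂(sphMeasure n) := by
  rw [pqCurvMeasure, setIntegral_revRadGaussSet hf h0 hh
    fun ρ h u => h ^ (-p) * ρ ^ q * radFun Q u ^ ((n : ℝ) - q)]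

/-- A dilation leaves the radial Gauss map unchanged and multiplies h by c and ρ by c, so the
integrand gains c^(-p) c^q. -/
theorem pqCurvMeasure_wulffSet_const_mul [Nonempty (Sph n)] {f : Sph n → ℝ} (hf : Continuous f)
    (h0 : ∀ v, 0 < f v) (hh : ∀ v, hull f v = f v) {c : ℝ} (hc : 0 < c) (p q : ℝ) (Q : Set (E n))
    (A : Set (Sph n)) :
    pqCurvMeasure p q (wulffSet fun v => c * f v) Q A =
      c ^ (q - p) * pqCurvMeasure p q (wulffSet f) Q A := by
  have hcf : Continuous fun w => (f w)⁻¹ := hf.inv₀ fun v => (h0 v).ne'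
  have hcm : Continuous fun v => c * f v := continuous_const.mul hf
  rw [pqCurvMeasure_wulffSet hcm (fun v => mul_pos hc (h0 v))
    (fun v => by rw [hull_const_mul hf h0 hc, hh]), pqCurvMeasure_wulffSet hf h0 hh,
    mul_left_comm, ← integral_const_mul (c ^ (q - p))]
  simp only [mul_inv]
  rw [argPolar_const_mul hcf (inv_pos.2 hc)]
  refine congrArg _ (integral_congr_ae (Eventually.of_forall fun u => ?_))
  have hN := inv_polarFun_inv_pos hf h0 u
  simp only
  rw [polarFun_const_mul hcf (inv_pos.2 hc).le, mul_inv, inv_inv, Real.mul_rpow hc.le (h0 _).le,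
    Real.mul_rpow hc.le hN.le, sub_eq_neg_add q, Real.rpow_add hc]
  ring

theorem nonempty_sph_of_measure_ne_zero {μ : Measure (Sph n)} (hμ : μ ≠ 0) : Nonempty (Sph n) := by
  by_contra h
  rw [not_nonempty_iff] at h
  exact hμ (Measure.eq_zero_of_isEmpty μ)

theorem pos_of_nonempty_sph [Nonempty (Sph n)] : 0 < n := by
  rcases Nat.eq_zero_or_pos n with rfl | h
  · have v := Classical.arbitrary (Sph 0)
    have h1 := norm_sph v
    rw [Subsingleton.elim (v : E 0) 0, norm_zero] at h1
    exact absurd h1 zero_ne_one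
  · exact h

/-- With G = t^q ρ_Q^(n-q) and ψ = t^p, ρG_t/ψ is q times the density of the (p,q)-measure. The sign
q < 0 gives monotonicity, blow-up at 0 and decay at ∞; p > 0 gives divergence. -/
theorem exists_pqCurvMeasure_eq_mul [Nonempty (Sph n)] {μ : Measure (Sph n)} [IsFiniteMeasure μ]
    (hμ0 : μ ≠ 0) (hμ : NotConcentrated μ) {p q : ℝ} (hp : 0 < p) (hq : q < 0) {Q : Set (E n)}
    (hQ : IsStarBody Q) :
    ∃ f : Sph n → ℝ, Continuous f ∧ (∀ v, 0 < f v) ∧ (∀ v, hull f v = f v) ∧ ∃ c > 0,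
      ∀ A : Set (Sph n), MeasurableSet A → μ.real A = c * pqCurvMeasure p q (wulffSet f) Q A := by
  have hn : (0 : ℝ) < n := Nat.cast_pos.2 (pos_of_nonempty_sph (n := n))
  set b : Sph n → ℝ := fun u => radFun Q (u : E n) ^ ((n : ℝ) - q) with hb
  have hb0 : ∀ u, 0 < b u := fun u => Real.rpow_pos_of_pos (hQ.radFun_pos u) _
  have hbc : Continuous b := hQ.radFun_cont.rpow_const fun u => Or.inl (hQ.radFun_pos u).ne'
  have hd : ∀ t > 0, ∀ u, HasDerivAt (fun s : ℝ => s ^ q * b u) (q * t ^ (q - 1) * b u) t :=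
    fun t ht u => (Real.hasDerivAt_rpow_const (Or.inl ht.ne')).mul_const _
  have hpT : ∀ t > 0, ∀ u, partialT (fun s u => s ^ q * b u) t u = q * t ^ (q - 1) * b u :=
    fun t ht u => (hd t ht u).deriv
  have hrp : ∀ a : ℝ, ContinuousOn (fun x : ℝ × Sph n => x.1 ^ a) (Ioi 0 ×ˢ univ) := fun a =>
    continuousOn_fst.rpow_const fun x hx => Or.inl (ne_of_gt hx.1)
  have hbc2 : ContinuousOn (fun x : ℝ × Sph n => b x.2) (Ioi 0 ×ˢ univ) :=
    (hbc.comp continuous_snd).continuousOn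
  obtain ⟨f, hf, h0, hh, l, hl⟩ := exists_supportFunction hμ0 hμ (ε := 1 / 2)
    (G := fun s u => s ^ q * b u) (ψ := fun t => t ^ p) ((hrp q).mul hbc2)
    (fun t ht u => (hd t ht u).differentiableAt)
    (((continuousOn_const.mul (hrp (q - 1))).mul hbc2).congr fun x hx => hpT x.1 hx.1 x.2)
    (fun t ht u => by
      rw [hpT t ht u]
      exact mul_neg_of_neg_of_pos (mul_neg_of_neg_of_pos hq (Real.rpow_pos_of_pos ht _)) (hb0 u))
    one_half_pos
    (fun v => by
      simp only [integral_const_mul]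
      exact (tendsto_rpow_neg_nhdsGT_zero hq).atTop_mul_const
        (setIntegral_cap_pos hbc hb0 one_half_lt_one v))
    (by
      simp only [integral_const_mul]
      have := (tendsto_rpow_neg_atTop (neg_pos.2 hq)).mul_const (∫ u, b u ∂(sphMeasure n))
      rwa [neg_neg, zero_mul] at this)
    (continuousOn_id.rpow_const fun t ht => Or.inl (ne_of_gt ht))
    (fun t ht => Real.rpow_pos_of_pos ht p) (lintegral_rpow_div_eq_top hp)
  have key : ∀ A : Set (Sph n), MeasurableSet A →
      μ.real A = (n * l * q) * pqCurvMeasure p q (wulffSet f) Q A := by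
    intro A hA
    have hne : (n : ℝ) * l * q * (1 / n) = l * q := by field_simp
    rw [hl A hA, pqCurvMeasure_wulffSet hf h0 hh, ← mul_assoc, hne, mul_assoc,
      ← integral_const_mul q]
    congr 2
    ext u
    have hN := inv_polarFun_inv_pos hf h0 u
    rw [hpT _ hN, Real.rpow_neg (h0 _).le, Real.rpow_sub_one hN.ne']
    simp only [hb]
    generalize (polarFun (fun w => (f w)⁻¹) (u : E n))⁻¹ = ρ at hN
    field_simp
  refine ⟨f, hf, h0, hh, n * l * q, ?_, key⟩
  -- The factor is positive because |μ| is positive and the total (p,q)-measure is nonnegative.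
  have h1 := key univ MeasurableSet.univ
  have h2 : 0 < μ.real univ := by
    have : NeZero μ := ⟨hμ0⟩
    exact measureReal_univ_pos
  have h3 : 0 ≤ pqCurvMeasure p q (wulffSet f) Q univ := by
    rw [pqCurvMeasure_wulffSet hf h0 hh]
    refine mul_nonneg (by positivity) (integral_nonneg fun u => ?_)
    exact mul_nonneg (mul_nonneg (Real.rpow_nonneg (h0 _).le _)
      (Real.rpow_nonneg (inv_polarFun_inv_pos hf h0 u).le _)) (hb0 u).le
  rw [h1] at h2
  exact pos_of_mul_pos_left h2 h3

end DualOrlicz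

end

/-! ### Assembly of the two statements -/

theorem mainTheorem1 (n : ℕ) (μ : Measure (DualOrlicz.Sph n)) [IsFiniteMeasure μ]
    (hμ0 : μ ≠ 0) (hμ : DualOrlicz.NotConcentrated μ) :
    -- the general dual Orlicz Minkowski problem
    (∀ (G : ℝ → DualOrlicz.Sph n → ℝ) (ψ : ℝ → ℝ) (ε₀ : ℝ),
      ContinuousOn (fun p : ℝ × DualOrlicz.Sph n => G p.1 p.2) (Ioi 0 ×ˢ univ) →
      (∀ t > 0, ∀ u, DifferentiableAt ℝ (fun s => G s u) t) →
      ContinuousOn (fun p : ℝ × DualOrlicz.Sph n => DualOrlicz.partialT G p.1 p.2)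
        (Ioi 0 ×ˢ univ) →
      (∀ t > 0, ∀ u, DualOrlicz.partialT G t u < 0) →
      0 < ε₀ → ε₀ < 1 →
      (∀ v : DualOrlicz.Sph n, ∀ ε : ℝ, 0 < ε → ε ≤ ε₀ →
        Tendsto (fun t => ∫ u in DualOrlicz.cap ε v, G t u ∂(DualOrlicz.sphMeasure n))
          (𝓝[>] 0) atTop) →
      Tendsto (fun t => ∫ u, G t u ∂(DualOrlicz.sphMeasure n)) atTop (𝓝 0) →
      ContinuousOn ψ (Ioi 0) →
      (∀ t > 0, 0 < ψ t) →
      ∫⁻ s in Ioi (1 : ℝ), ENNReal.ofReal (ψ s / s) = ⊤ →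
      ∃ K : ConvexBody (DualOrlicz.E n), DualOrlicz.IsKo K ∧
        DualOrlicz.curvMeasure G ψ K univ ≠ 0 ∧
        ∀ A : Set (DualOrlicz.Sph n), MeasurableSet A →
          μ.real A / μ.real univ =
            DualOrlicz.curvMeasure G ψ K A / DualOrlicz.curvMeasure G ψ K univ) ∧
    -- the `(p,q)`-dual Minkowski problem for `p > 0` and `q < 0`
    (∀ (p q : ℝ) (Q : Set (DualOrlicz.E n)), 0 < p → q < 0 → DualOrlicz.IsStarBody Q →
      ∃ K : ConvexBody (DualOrlicz.E n), DualOrlicz.IsKo K ∧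
        ∀ A : Set (DualOrlicz.Sph n), MeasurableSet A →
          μ.real A = DualOrlicz.pqCurvMeasure p q K Q A) := by 
  have hne := DualOrlicz.nonempty_sph_of_measure_ne_zero hμ0
  have hn : (0 : ℝ) < n := Nat.cast_pos.2 (DualOrlicz.pos_of_nonempty_sph (n := n))
  have hμpos : 0 < μ.real univ := by
    have : NeZero μ := ⟨hμ0⟩
    exact measureReal_univ_pos
  constructor
  · intro G ψ ε₀ hG hGd hG' hneg hε₀ _ hcap hinf hψ hψ0 hint
    obtain ⟨f, hf, h0, hh, l, hl⟩ := DualOrlicz.exists_supportFunction hμ0 hμ hG hGd hG' hneg hε₀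
      (fun v => hcap v ε₀ hε₀ le_rfl) hinf hψ hψ0 hint
    have key : ∀ A : Set (DualOrlicz.Sph n), MeasurableSet A →
        μ.real A = l * n * DualOrlicz.curvMeasure G ψ (DualOrlicz.wulffBody hf h0) A := by
      intro A hA
      change _ = l * n * DualOrlicz.curvMeasure G ψ (DualOrlicz.wulffSet f) A
      rw [DualOrlicz.curvMeasure_wulffSet hf h0 hh, hl A hA]
      field_simp
    have h1 := key univ MeasurableSet.univ
    rw [h1] at hμpos
    have hC := right_ne_zero_of_mul hμpos.ne'
    have hln := left_ne_zero_of_mul hμpos.ne'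
    refine ⟨DualOrlicz.wulffBody hf h0, DualOrlicz.isKo_wulffBody hf h0, hC, fun A hA => ?_⟩
    rw [h1, key A hA, mul_div_mul_left _ _ hln]
  · intro p q Q hp hq hQ
    obtain ⟨f, hf, h0, hh, c, hc, key⟩ :=
      DualOrlicz.exists_pqCurvMeasure_eq_mul hμ0 hμ hp hq hQ
    -- Dilation by s multiplies the measure by s^(q-p); as q - p < 0, this s absorbs the factor c
    -- exactly.
    have hs : 0 < c ^ (q - p)⁻¹ := Real.rpow_pos_of_pos hc _
    refine ⟨DualOrlicz.wulffBody (continuous_const.mul hf) fun v => mul_pos hs (h0 v),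
      DualOrlicz.isKo_wulffBody _ _, fun A hA => ?_⟩
    change _ = DualOrlicz.pqCurvMeasure p q (DualOrlicz.wulffSet fun v => c ^ (q - p)⁻¹ * f v) Q A
    rw [DualOrlicz.pqCurvMeasure_wulffSet_const_mul hf h0 hh hs,
      Real.rpow_inv_rpow hc.le (by linarith), key A hA]
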